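/- Let $G$ be a discrete group, let $p$ be a prime, and let $\mathcal E$ be the collection of all nontrivial elementary abelian $p$-subgroups of $G$ (nontrivial abelian subgroups in which every element $x$ satisfies $x^p=1$), or the collection of all finite such subgroups. Let $\mathcal A_{\mathcal E}(G)$ be the category whose objects are the pairs $(H,[i])$, where $H$ is a group and $[i]$ is a $G$-conjugacy class of monomorphisms $i\colon H\to G$ with $i(H)\in\mathcal E$ ($G$ acts on these by $g\cdot i=c_g\circ i$, $c_g(x)=gxg^{-1}$), and whose morphisms $(H,[i])\to(H',[i'])$ are the group homomorphisms $f\colon H\to H'$ with $[i]=[i'\circ f]$. Let $\widetilde\alpha\colon \mathcal A_{\mathcal E}(G)^{op}\to G\text{-Sets}$ be the functor that sends $(H,[i])$ to the $G$-set $[i]$ and a morphism $f$ to precomposition with $f$, and let $$X=\operatorname{hocolim}_{\mathcal A_{\mathcal E}(G)^{op}}\widetilde\alpha$$ be the Dwyer space for the centralizer decomposition, that is, the $G$-space obtained as the geometric realization of the simplicial set whose $n$-simplices are the pairs of a chain $d_0\to\cdots\to d_n$ in $\mathcal A_{\mathcal E}(G)^{op}$ and an element of $\widetilde\alpha(d_0)$,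 with $G$ acting on the second component. Then for every nontrivial finite $p$-subgroup $P\le G$, the fixed point subspace $X^P$ and the orbit space $C_G(P)\backslash X^P$ are contractible. -/

import Mathlib

open CategoryTheory

universe w v u

noncomputable section

namespace Dwyer

/-! ### Homotopy colimits of diagrams of sets and of `G`-sets -/

section Hocolim

variable {D : Type u} [Category.{v} D]

theorem chain_map_map (F : D ⥤ Type w) {n : ℕ} (s : ComposableArrows D n) {i j k : Fin (n + 1)}
    (f : i ⟶ j) (g : j ⟶ k) (h : i ⟶ k) (x : F.obj (s.obj i)) :
    F.map (s.map h) x = F.map (s.map g) (F.map (s.map f) x) := by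
  rw [Subsingleton.elim h (f ≫ g)]
  simp

/-- The homotopy colimit (simplicial replacement) of a diagram of sets `F`, viewed as a diagram
of discrete simplicial sets: its `n`-simplices are the pairs of a chain `d₀ ⟶ ⋯ ⟶ dₙ` in `D`
and an element of `F d₀`. A map `φ : [m] → [n]` sends `(d, x)` to the chain `d ∘ φ` together with
the image of `x` in `F (d (φ 0))`. -/
def hocolim (F : D ⥤ Type w) : SSet.{max u v w} where
  obj n := Σ s : ComposableArrows D n.unop.len, F.obj (s.obj 0)
  map φ := ↾fun a ↦
    ⟨a.1.whiskerLeft (SimplexCategory.toCat.map φ.unop).toFunctor,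
      F.map (a.1.map (homOfLE (Fin.zero_le _))) a.2⟩
  map_id n := by
    refine ConcreteCategory.hom_ext _ _ fun ⟨s, x⟩ ↦ ?_
    refine congrArg (Sigma.mk (β := fun s : ComposableArrows D n.unop.len ↦ F.obj (s.obj 0)) s)
      (a₂ := x) ?_
    have h : s.map (homOfLE (Fin.zero_le (0 : Fin (n.unop.len + 1)))) = 𝟙 (s.obj 0) :=
      s.map_id 0
    exact (congrArg (fun k ↦ F.map k x) h).trans (by simp)
  map_comp {a b c} φ ψ := by
    refine ConcreteCategory.hom_ext _ _ fun ⟨s, x⟩ ↦ ?_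
    refine congrArg (Sigma.mk (β := fun s : ComposableArrows D c.unop.len ↦ F.obj (s.obj 0))
      (s.whiskerLeft (SimplexCategory.toCat.map (φ ≫ ψ).unop).toFunctor)) ?_
    exact chain_map_map F s _ _ _ x

/-- A natural transformation of diagrams of sets induces a map of homotopy colimits. -/
def hocolimMap {F F' : D ⥤ Type w} (η : F ⟶ F') : hocolim F ⟶ hocolim F' where
  app n := ↾fun a ↦ ⟨a.1, η.app _ a.2⟩
  naturality m n φ := by
    ext ⟨s, x⟩
    refine Sigma.ext rfl (heq_of_eq ?_)
    exact (NatTrans.naturality_apply η _ x)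

variable {G : Type*} [Group G]

/-- The action of `g : G` on a diagram of `G`-sets. -/
def actNatTrans (F : D ⥤ Action (Type w) G) (g : G) :
    F ⋙ Action.forget (Type w) G ⟶ F ⋙ Action.forget (Type w) G where
  app d := (F.obj d).ρ g
  naturality _ _ f := ((F.map f).comm g).symm

/-- The homotopy colimit of a diagram of `G`-sets, as a `G`-simplicial set: `g (d, x) = (d, g x)`. -/
def hocolimAction (F : D ⥤ Action (Type w) G) : Action SSet.{max u v w} G where
  V := hocolim (F ⋙ Action.forget (Type w) G)
  ρ :=
    { toFun g := hocolimMap (actNatTrans F g)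
      map_one' := by
        refine NatTrans.ext (funext fun n ↦ ConcreteCategory.hom_ext _ _ fun ⟨s, x⟩ ↦ ?_)
        exact congrArg (Sigma.mk (β := fun s : ComposableArrows D n.unop.len ↦ (F.obj (s.obj 0)).V)
          s) (ConcreteCategory.congr_hom ((F.obj (s.obj 0)).ρ_one) x)
      map_mul' g h := by
        refine NatTrans.ext (funext fun n ↦ ConcreteCategory.hom_ext _ _ fun ⟨s, x⟩ ↦ ?_)
        exact congrArg (Sigma.mk (β := fun s : ComposableArrows D n.unop.len ↦ (F.obj (s.obj 0)).V)
          s) (ConcreteCategory.congr_hom ((F.obj (s.obj 0)).ρ.map_mul g h) x) }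

end Hocolim

/-! ### The conjugacy category of a collection of subgroups -/

section Conjugacy

variable (H G : Type u) [Group H] [Group G]

/-- Two homomorphisms `i, j : H → G` are `G`-conjugate if `j = c_g ∘ i` for some `g : G`, where
`c_g x = g x g⁻¹`. -/
def conjSetoid : Setoid (H →* G) where
  r i j := ∃ g : G, j = (MulAut.conj g).toMonoidHom.comp i
  iseqv :=
    { refl i := ⟨1, by ext; simp⟩
      symm := by
        rintro i j ⟨g, rfl⟩
        exact ⟨g⁻¹, by ext; simp [mul_assoc]⟩
      trans := by
        rintro i j k ⟨g, rfl⟩ ⟨h, rfl⟩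
        exact ⟨h * g, by ext; simp [mul_assoc]⟩ }

/-- The `G`-conjugacy classes of homomorphisms `H → G`. -/
def ConjHom : Type u := Quotient (conjSetoid H G)

variable {H G}

/-- The conjugacy class `[i]`. -/
def ConjHom.mk (i : H →* G) : ConjHom H G := Quotient.mk (conjSetoid H G) i

theorem ConjHom.mk_eq_iff {i j : H →* G} :
    ConjHom.mk i = ConjHom.mk j ↔ ∃ g : G, j = (MulAut.conj g).toMonoidHom.comp i :=
  Quotient.eq (r := conjSetoid H G)

/-- The class `[i ∘ f]`, for a conjugacy class `[i]` and a homomorphism `f`. -/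
def ConjHom.precomp {K : Type u} [Group K] (c : ConjHom H G) (f : K →* H) : ConjHom K G :=
  Quotient.map' (s₁ := conjSetoid H G) (s₂ := conjSetoid K G) (fun i ↦ i.comp f)
    (by rintro i j ⟨g, rfl⟩; exact ⟨g, rfl⟩) c

theorem ConjHom.precomp_mk {K : Type u} [Group K] (i : H →* G) (f : K →* H) :
    (ConjHom.mk i).precomp f = ConjHom.mk (i.comp f) := rfl

theorem ConjHom.precomp_id (c : ConjHom H G) : c.precomp (MonoidHom.id H) = c :=
  Quotient.inductionOn c fun _ ↦ rfl

theorem ConjHom.precomp_precomp {K L : Type u} [Group K] [Group L] (c : ConjHom H G)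
    (f : K →* H) (k : L →* K) : (c.precomp f).precomp k = c.precomp (f.comp k) :=
  Quotient.inductionOn c fun _ ↦ rfl

/-- A class `c`, as the set of homomorphisms in it. -/
def ConjHom.Elem (c : ConjHom H G) : Type u := {i : H →* G // ConjHom.mk i = c}

/-- `G` acts on a conjugacy class by `g • i = c_g ∘ i`. -/
instance (c : ConjHom H G) : MulAction G c.Elem where
  smul g i := ⟨(MulAut.conj g).toMonoidHom.comp i.1,
    (ConjHom.mk_eq_iff.2 ⟨g, rfl⟩ : ConjHom.mk i.1 = _).symm.trans i.2⟩
  one_smul i := Subtype.ext (by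
    change (MulAut.conj (1 : G)).toMonoidHom.comp i.1 = i.1
    ext; simp)
  mul_smul g h i := Subtype.ext (by
    change (MulAut.conj (g * h)).toMonoidHom.comp i.1 =
      (MulAut.conj g).toMonoidHom.comp ((MulAut.conj h).toMonoidHom.comp i.1)
    ext; simp [mul_assoc])

/-- The objects of the `𝓒`-conjugacy category: pairs `(H, [i])` of a group `H` and a
`G`-conjugacy class of monomorphisms `i : H → G` with `i(H) ∈ 𝓒`. (The last condition does not
depend on the representative when `𝓒` is closed under conjugation.) -/
structure ConjugacyCategory (𝓒 : Set (Subgroup G)) : Type (u + 1) where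
  /-- the group `H` -/
  carrier : Type u
  [group : Group carrier]
  /-- the conjugacy class `[i]` -/
  cls : ConjHom carrier G
  injective : ∀ i : carrier →* G, ConjHom.mk i = cls → Function.Injective i
  range_mem : ∀ i : carrier →* G, ConjHom.mk i = cls → i.range ∈ 𝓒

attribute [instance] ConjugacyCategory.group

variable {𝓒 : Set (Subgroup G)}

/-- A morphism `(H, [i]) → (H', [i'])` is a homomorphism `f : H → H'` with `[i] = [i' ∘ f]`. -/
@[ext]
structure ConjugacyCategory.Hom (X Y : ConjugacyCategory 𝓒) : Type u where
  /-- the underlying group homomorphism -/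
  toMonoidHom : X.carrier →* Y.carrier
  cls_eq : X.cls = Y.cls.precomp toMonoidHom

instance : Category.{u} (ConjugacyCategory 𝓒) where
  Hom X Y := ConjugacyCategory.Hom X Y
  id X := ⟨MonoidHom.id _, (ConjHom.precomp_id _).symm⟩
  comp f g := ⟨g.toMonoidHom.comp f.toMonoidHom, by
    rw [← ConjHom.precomp_precomp, ← g.cls_eq, f.cls_eq]⟩

variable (𝓒)

/-- The functor `(H, [i]) ↦ [i]` from the opposite of the `𝓒`-conjugacy category to `G`-sets; a
morphism `f` acts by precomposition. -/
def conjClassFunctor : (ConjugacyCategory 𝓒)ᵒᵖ ⥤ Action (Type u) G where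
  obj X := Action.ofMulAction G X.unop.cls.Elem
  map {_ Y} f :=
    { hom := ↾fun i ↦ (⟨i.1.comp f.unop.toMonoidHom, 
        (congrArg (ConjHom.precomp · f.unop.toMonoidHom) i.2).trans f.unop.cls_eq.symm⟩ : Y.unop.cls.Elem)
      comm _ := rfl }
  map_id _ := rfl
  map_comp _ _ := rfl

/-- The Dwyer space for the centralizer decomposition over `𝓒`: the (geometric realization of
the) homotopy colimit of `(H, [i]) ↦ [i]`, with its `G`-action. -/
def dwyerSpace : Action TopCat.{u + 1} G :=
  (SSet.toTop.{u + 1}.mapAction G).obj (hocolimAction (conjClassFunctor 𝓒))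

end Conjugacy

/-! ### Elementary abelian subgroups -/

/-- The collection of all nontrivial elementary abelian `p`-subgroups of `G`, that is, of all
nontrivial abelian subgroups of exponent `p`. -/
def elementaryAbelianSubgroups (p : ℕ) (G : Type*) [Group G] : Set (Subgroup G) :=
  {E | E ≠ ⊥ ∧ (∀ x ∈ E, ∀ y ∈ E, x * y = y * x) ∧ ∀ x ∈ E, x ^ p = 1}

/-- The collection of all nontrivial finite elementary abelian `p`-subgroups of `G`. -/
def finiteElementaryAbelianSubgroups (p : ℕ) (G : Type*) [Group G] : Set (Subgroup G) :=
  {E | E ∈ elementaryAbelianSubgroups p G ∧ Finite E}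

/-! ### Fixed point subspaces and orbit spaces of `G`-spaces -/

section Fixed

variable {G : Type*} [Group G]

/-- The action of `G` on the points of a `G`-space. -/
instance (X : Action TopCat.{w} G) : MulAction G X.V := Action.instMulAction X

variable (X : Type*) [MulAction G X] (P : Subgroup G)

/-- The fixed point set `X^P` with its action of the centralizer `C_G(P)`. -/
def fixedPoints : SubMulAction (Subgroup.centralizer (P : Set G)) X where
  carrier := MulAction.fixedPoints P X
  smul_mem' c x hx q := by
    have h : (q : G) * (c : G) = (c : G) * (q : G) := Subgroup.mem_centralizer_iff.1 c.2 q q.2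
    calc (q : G) • (c : G) • x = (c : G) • (q : G) • x := by rw [smul_smul, smul_smul, h]
      _ = (c : G) • x := congrArg ((c : G) • ·) (hx q)

/-- The orbit space `C_G(P) \ X^P`; for a topological space `X` it carries the quotient topology
of the subspace topology. -/
abbrev fixedPointsOrbitSpace : Type _ :=
  Quotient (MulAction.orbitRel (Subgroup.centralizer (P : Set G)) (fixedPoints X P))

end Fixed

end Dwyer

end

/-! Since the maps `i : H → G` are injective, an arrow of the diagram is determined by its effect on
any one element of its source. Hence the simplicial set underlying `X` is the nerve of the preorder
of all monomorphisms `i`, where `i ≤ j` means that the image of `j` lies in the image of `i`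
(`hocolimToNerve_bijective`, `element_le_iff`). A monomorphism is fixed by `P` exactly when its
image centralizes `P`. Such monomorphisms form an upper set, and `X^P` is homeomorphic, compatibly
with `C_G(P)`, to the realization of this upper set (`exists_homeomorph_fixedPoints`).

A nontrivial finite `p`-group `P` has a central subgroup `Z` of order `p`. If `E` is an elementary
abelian subgroup centralizing `P`, then `EZ` is again one, and `E ≤ EZ ≥ Z`. This gives a zigzag `T
x ≤ x`, `T x ≤ q` of monotone maps on the preorder, with `q` the inclusion of `Z`. Comparable
monotone maps have homotopic realizations (`exists_homotopy_of_le`), so the identity is homotopic to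
a constant map.

For the orbit space the homotopies have to be compatible with `C_G(P)`. They are natural in the
preorder, so it suffices that `T` commutes strictly with `C_G(P)` and that `q` is fixed. The
centralizer fixes `q` because it fixes `Z` pointwise. For `T`, the monomorphism with image `EZ` is
defined on `(H × Z) / ker`, a group that does not change when `i` is conjugated. The whole argument
is `contractibleSpace_dwyerSpace`. -/

noncomputable section

namespace Dwyer

/-! ### Points of a geometric realization and maps out of it. -/

section Realization

open Opposite

variable {S S' : SSet.{w}}

theorem sset_naturality_apply {S T : SSet.{w}} (η : S ⟶ T) {m n : SimplexCategoryᵒᵖ} (φ : m ⟶ n)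
    (σ : S.obj m) : η.app n (S.map φ σ) = T.map φ (η.app m σ) :=
  NatTrans.naturality_apply η φ σ

/-- The unit `S ⟶ Sing |S|` of the adjunction between realization and singular simplicial sets. -/
def singUnit (S : SSet.{w}) : S ⟶ TopCat.toSSet.obj (SSet.toTop.obj S) :=
  sSetTopAdj.unit.app S

/-- The characteristic map `|Δⁿ| → |S|` of an `n`-simplex of `S`. -/
def simplexPoint {n : SimplexCategoryᵒᵖ} (σ : S.obj n) :
    C(stdSimplex ℝ (Fin (n.unop.len + 1)), SSet.toTop.obj S) :=
  TopCat.toSSetObjEquiv _ n ((singUnit S).app n σ)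

theorem toSSetObjEquiv_map (X : TopCat.{w}) {m n : SimplexCategoryᵒᵖ} (φ : m ⟶ n)
    (a : (TopCat.toSSet.obj X).obj m) (t : stdSimplex ℝ (Fin (n.unop.len + 1))) :
    TopCat.toSSetObjEquiv X n ((TopCat.toSSet.obj X).map φ a) t =
      TopCat.toSSetObjEquiv X m a (stdSimplex.map φ.unop t) := rfl

theorem simplexPoint_map {m n : SimplexCategoryᵒᵖ} (φ : m ⟶ n) (σ : S.obj m)
    (t : stdSimplex ℝ (Fin (n.unop.len + 1))) :
    simplexPoint (S.map φ σ) t = simplexPoint σ (stdSimplex.map φ.unop t) := by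
  have h : (singUnit S).app n (S.map φ σ) =
      (TopCat.toSSet.obj (SSet.toTop.obj S)).map φ ((singUnit S).app m σ) :=
    sset_naturality_apply (singUnit S) φ σ
  exact (congrArg (fun a ↦ TopCat.toSSetObjEquiv _ n a t) h).trans
    (toSSetObjEquiv_map (SSet.toTop.obj S) φ ((singUnit S).app m σ) t)

theorem toTop_map_simplexPoint (f : S ⟶ S') {n : SimplexCategoryᵒᵖ} (σ : S.obj n)
    (t : stdSimplex ℝ (Fin (n.unop.len + 1))) :
    SSet.toTop.map f (simplexPoint σ t) = simplexPoint (f.app n σ) t := by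
  have h := ConcreteCategory.congr_hom (NatTrans.congr_app (sSetTopAdj.unit.naturality f) n) σ
  exact (congrArg (fun a ↦ TopCat.toSSetObjEquiv _ n a t) h).symm

theorem toTop_hom_ext {Y : TopCat.{w}} {f g : SSet.toTop.obj S ⟶ Y}
    (h : ∀ (n : SimplexCategoryᵒᵖ) (σ : S.obj n) (t : stdSimplex ℝ (Fin (n.unop.len + 1))),
      f (simplexPoint σ t) = g (simplexPoint σ t)) : f = g := by
  apply (sSetTopAdj.homEquiv _ _).injective
  refine NatTrans.ext (funext fun n ↦ ConcreteCategory.hom_ext _ _ fun σ ↦ ?_)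
  apply (TopCat.toSSetObjEquiv _ _).injective
  ext t
  rw [Adjunction.homEquiv_unit, Adjunction.homEquiv_unit]
  exact h n σ t

/-- A natural family of continuous maps `|Δⁿ| → Y`, indexed by the simplices of `S`, glues to a
continuous map `|S| → Y`. -/
theorem exists_continuousMap_toTop {Y : Type w} [TopologicalSpace Y]
    (k : ∀ n : SimplexCategoryᵒᵖ, S.obj n → C(stdSimplex ℝ (Fin (n.unop.len + 1)), Y))
    (hk : ∀ (m n : SimplexCategoryᵒᵖ) (φ : m ⟶ n) (σ : S.obj m)
      (t : stdSimplex ℝ (Fin (n.unop.len + 1))),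
      k n (S.map φ σ) t = k m σ (stdSimplex.map φ.unop t)) :
    ∃ K : C(SSet.toTop.obj S, Y), ∀ (n : SimplexCategoryᵒᵖ) (σ : S.obj n)
      (t : stdSimplex ℝ (Fin (n.unop.len + 1))), K (simplexPoint σ t) = k n σ t := by
  let κ : S ⟶ TopCat.toSSet.obj (TopCat.of Y) :=
    { app n := ↾fun σ ↦ (TopCat.toSSetObjEquiv (TopCat.of Y) n).symm (k n σ)
      naturality m n φ := by
        refine ConcreteCategory.hom_ext _ _ fun σ ↦ ?_
        apply (TopCat.toSSetObjEquiv _ _).injective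
        ext t
        exact hk m n φ σ t }
  refine ⟨((sSetTopAdj.homEquiv _ _).symm κ).hom, fun n σ t ↦ ?_⟩
  have h := (sSetTopAdj.homEquiv _ _).apply_symm_apply κ
  rw [Adjunction.homEquiv_unit] at h
  exact congrArg (fun a ↦ TopCat.toSSetObjEquiv (TopCat.of Y) n a t)
    (ConcreteCategory.congr_hom (NatTrans.congr_app h n) σ)

/-- The characteristic maps glue to a map from the realization into the subspace `R` that they
cover. Followed by the inclusion of `R`, it agrees with the identity on every simplex, hence is the
identity. -/
theorem exists_simplexPoint (x : SSet.toTop.obj S) :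
    ∃ (n : SimplexCategoryᵒᵖ) (σ : S.obj n) (t : stdSimplex ℝ (Fin (n.unop.len + 1))),
      simplexPoint σ t = x := by
  let R : Set (SSet.toTop.obj S) := {x | ∃ (n : SimplexCategoryᵒᵖ) (σ : S.obj n)
    (t : stdSimplex ℝ (Fin (n.unop.len + 1))), simplexPoint σ t = x}
  obtain ⟨K, hK⟩ := exists_continuousMap_toTop (S := S) (Y := R)
    (fun n σ ↦ ⟨fun t ↦ ⟨simplexPoint σ t, n, σ, t, rfl⟩, by fun_prop⟩)
    (fun m n φ σ t ↦ Subtype.ext (simplexPoint_map φ σ t))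
  have h : TopCat.ofHom ((ContinuousMap.mk Subtype.val continuous_subtype_val).comp K) =
      𝟙 (SSet.toTop.obj S) := toTop_hom_ext fun n σ t ↦ congrArg Subtype.val (hK n σ t)
  have hx : ((K x : R) : SSet.toTop.obj S) = x := ConcreteCategory.congr_hom h x
  rw [← hx]
  exact (K x).2

end Realization

/-! ### Barycentric coordinates under maps of vertices. -/

section StdSimplex

variable {X Y : Type*} [Fintype X] [Fintype Y]

theorem stdSimplex_map_apply [DecidableEq Y] (f : X → Y) (t : stdSimplex ℝ X) (y : Y) :
    stdSimplex.map f t y = ∑ x with f x = y, t x := by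
  rw [stdSimplex.map_coe, FunOnFinite.linearMap_apply_apply]

theorem stdSimplex_sum_map (f : X → Y) (t : stdSimplex ℝ X) (p : Y → Prop) [DecidablePred p] :
    ∑ y with p y, stdSimplex.map f t y = ∑ x with p (f x), t x := by
  classical
  simp only [stdSimplex_map_apply, Finset.sum_filter]
  rw [← Finset.sum_fiberwise Finset.univ f]
  refine Finset.sum_congr rfl fun y _ ↦ ?_
  by_cases hy : p y
  · rw [if_pos hy, Finset.sum_filter]
    refine Finset.sum_congr rfl fun x _ ↦ ?_
    by_cases hx : f x = y <;> simp [hx, hy]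
  · rw [if_neg hy]
    refine (Finset.sum_eq_zero fun x hx ↦ ?_).symm
    rw [Finset.mem_filter] at hx
    simp [hx.2, hy]

theorem stdSimplex_exists_pos (t : stdSimplex ℝ X) : ∃ x, 0 < t x := by
  by_contra! h
  have h0 : ∑ x, t x = 0 := Finset.sum_eq_zero fun x _ ↦ le_antisymm (h x) (stdSimplex.zero_le t x)
  rw [stdSimplex.sum_eq_one] at h0
  exact one_ne_zero h0

theorem stdSimplex_map_pos (f : X → Y) (t : stdSimplex ℝ X) {x : X} (hx : 0 < t x) :
    0 < stdSimplex.map f t (f x) := by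
  classical
  rw [stdSimplex_map_apply]
  refine hx.trans_le (Finset.single_le_sum (f := fun x ↦ t x) (fun y _ ↦ stdSimplex.zero_le t y) ?_)
  simp

theorem stdSimplex_exists_first {n : ℕ} (t : stdSimplex ℝ (Fin (n + 1))) :
    ∃ k, 0 < t k ∧ ∀ j < k, t j = 0 := by
  obtain ⟨k, hk, hmin⟩ := WellFounded.has_min (wellFounded_lt (α := Fin (n + 1))) {k | 0 < t k}
    (stdSimplex_exists_pos t)
  exact ⟨k, hk, fun j hj ↦ le_antisymm (not_lt.1 fun h ↦ hmin j h hj) (stdSimplex.zero_le t j)⟩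

theorem stdSimplex_continuous_apply (x : X) : Continuous fun t : stdSimplex ℝ X ↦ t x :=
  (continuous_apply x).comp continuous_subtype_val

end StdSimplex

/-! ### Realization of the nerve of a preorder. -/

section OrderNerve

open Opposite

variable {Q Q' : Type w} [Preorder Q] [Preorder Q']

/-- The nerve of a preorder: its `n`-simplices are the monotone maps `[n] → Q`. -/
def orderNerve (Q : Type w) [Preorder Q] : SSet.{w} where
  obj n := Fin (n.unop.len + 1) →o Q
  map φ := ↾fun v ↦ v.comp (SimplexCategory.Hom.toOrderHom φ.unop)
  map_id _ := rfl
  map_comp _ _ := rfl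

/-- The map of nerves induced by a monotone map. -/
def orderNerveMap (f : Q →o Q') : orderNerve Q ⟶ orderNerve Q' where
  app _ := ↾fun v ↦ OrderHom.comp f v
  naturality _ _ _ := rfl

/-- The geometric realization of the nerve of a preorder. -/
abbrev OrderRealization (Q : Type w) [Preorder Q] : Type w :=
  SSet.toTop.obj (orderNerve Q)

/-- The characteristic map of a chain `v₀ ≤ ⋯ ≤ vₙ`. -/
def chainPoint {n : ℕ} (v : Fin (n + 1) →o Q) :
    C(stdSimplex ℝ (Fin (n + 1)), OrderRealization Q) :=
  simplexPoint (S := orderNerve Q) (n := op (SimplexCategory.mk n)) v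

theorem chainPoint_comp {m n : ℕ} (v : Fin (n + 1) →o Q) (φ : Fin (m + 1) →o Fin (n + 1))
    (t : stdSimplex ℝ (Fin (m + 1))) :
    chainPoint (v.comp φ) t = chainPoint v (stdSimplex.map φ t) :=
  simplexPoint_map (S := orderNerve Q) (m := op (SimplexCategory.mk n))
    (n := op (SimplexCategory.mk m)) (Quiver.Hom.op (SimplexCategory.Hom.mk φ)) v t

theorem exists_chainPoint (x : OrderRealization Q) :
    ∃ (n : ℕ) (v : Fin (n + 1) →o Q) (t : stdSimplex ℝ (Fin (n + 1))), chainPoint v t = x := by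
  obtain ⟨n, v, t, h⟩ := exists_simplexPoint x
  exact ⟨n.unop.len, v, t, h⟩

theorem exists_continuousMap_orderRealization {Y : Type w} [TopologicalSpace Y]
    (k : ∀ n : ℕ, (Fin (n + 1) →o Q) → C(stdSimplex ℝ (Fin (n + 1)), Y))
    (hk : ∀ (m n : ℕ) (φ : Fin (m + 1) →o Fin (n + 1)) (v : Fin (n + 1) →o Q)
      (t : stdSimplex ℝ (Fin (m + 1))), k m (v.comp φ) t = k n v (stdSimplex.map φ t)) :
    ∃ K : C(OrderRealization Q, Y), ∀ (n : ℕ) (v : Fin (n + 1) →o Q)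
      (t : stdSimplex ℝ (Fin (n + 1))), K (chainPoint v t) = k n v t := by
  obtain ⟨K, hK⟩ := exists_continuousMap_toTop (S := orderNerve Q) (fun n v ↦ k n.unop.len v)
    (fun m n φ v t ↦ hk n.unop.len m.unop.len (SimplexCategory.Hom.toOrderHom φ.unop) v t)
  exact ⟨K, fun n v t ↦ hK (op (SimplexCategory.mk n)) v t⟩

/-- The map of realizations induced by a monotone map. -/
def orderRealizationMap (f : Q →o Q') : C(OrderRealization Q, OrderRealization Q') :=
  (SSet.toTop.map (orderNerveMap f)).hom

theorem orderRealizationMap_chainPoint (f : Q →o Q') {n : ℕ} (v : Fin (n + 1) →o Q)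
    (t : stdSimplex ℝ (Fin (n + 1))) :
    orderRealizationMap f (chainPoint v t) = chainPoint (f.comp v) t :=
  toTop_map_simplexPoint (orderNerveMap f) (n := op (SimplexCategory.mk n)) v t

/-- The point `chainPoint v t` only depends on the vertices of positive weight. -/
theorem chainPoint_congr {n : ℕ} {v v' : Fin (n + 1) →o Q} (t : stdSimplex ℝ (Fin (n + 1)))
    (h : ∀ j, 0 < t j → v j = v' j) : chainPoint v t = chainPoint v' t := by
  classical
  -- The point `t` lies on the face `e` spanned by its vertices of positive weight, and the two
  -- chains have the same restriction to that face.
  let s : Finset (Fin (n + 1)) := {j | 0 < t j}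
  have hs : s.Nonempty := (stdSimplex_exists_pos t).imp fun k hk ↦ by simpa [s] using hk
  obtain ⟨m, hm⟩ : ∃ m, s.card = m + 1 := ⟨s.card - 1, (Nat.succ_pred_eq_of_pos hs.card_pos).symm⟩
  let e : Fin (m + 1) ↪o Fin (n + 1) := s.orderEmbOfFin hm
  have he : ∀ i, 0 < t (e i) := fun i ↦ (Finset.mem_filter.1 (s.orderEmbOfFin_mem hm i)).2
  have hsum : ∀ f : Fin (n + 1) → ℝ, (∀ j, ¬ 0 < t j → f j = 0) →
      ∑ i, f (e i) = ∑ j, f j := by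
    intro f hf
    have h1 : ∑ i, f (e i) = ∑ j ∈ s, f j := by
      have himg : s = Finset.univ.map e.toEmbedding := by
        ext j
        have : j ∈ Set.range e ↔ j ∈ (s : Set _) := by rw [Finset.range_orderEmbOfFin s hm]
        simpa using this.symm
      rw [himg, Finset.sum_map]
      rfl
    rw [h1]
    refine Finset.sum_subset (Finset.subset_univ s) fun j _ hj ↦ hf j ?_
    simpa [s] using hj
  let t' : stdSimplex ℝ (Fin (m + 1)) := ⟨fun i ↦ t (e i), fun i ↦ stdSimplex.zero_le t _, by
    rw [hsum (fun j ↦ t j) fun j hj ↦ le_antisymm (not_lt.1 hj) (stdSimplex.zero_le t j)]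
    exact stdSimplex.sum_eq_one t⟩
  have ht : t = stdSimplex.map (OrderHomClass.toOrderHom e) t' := by
    ext j
    rw [stdSimplex_map_apply, Finset.sum_filter]
    change t j = ∑ i, if e i = j then t (e i) else 0
    rw [hsum (fun i ↦ if i = j then t i else 0)]
    · simp
    · intro i hi
      split_ifs
      exacts [le_antisymm (not_lt.1 hi) (stdSimplex.zero_le t i), rfl]
  rw [ht, ← chainPoint_comp, ← chainPoint_comp]
  congr 1
  congr 1
  ext i
  exact h _ (he i)

/-- The first vertex of positive weight of a point of the realization of a preorder. -/
theorem exists_firstVertex (Q : Type w) [Preorder Q] :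
    ∃ f : OrderRealization Q → Q, ∀ (n : ℕ) (v : Fin (n + 1) →o Q) (t : stdSimplex ℝ (Fin (n + 1)))
      (k : Fin (n + 1)), 0 < t k → (∀ j < k, t j = 0) → f (chainPoint v t) = v k := by
  -- With the indiscrete topology every map to `Q` is continuous, so the universal property of the
  -- realization also yields this discontinuous function.
  let _ : TopologicalSpace Q := ⊤
  have huniq : ∀ {n : ℕ} (t : stdSimplex ℝ (Fin (n + 1))) {k l : Fin (n + 1)},
      (0 < t k ∧ ∀ j < k, t j = 0) → (0 < t l ∧ ∀ j < l, t j = 0) → k = l := by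
    intro n t k l hk hl
    refine le_antisymm (not_lt.1 fun h ↦ ?_) (not_lt.1 fun h ↦ ?_)
    · exact hl.1.ne' (hk.2 l h)
    · exact hk.1.ne' (hl.2 k h)
  choose first hfirst using fun n ↦ stdSimplex_exists_first (n := n)
  obtain ⟨K, hK⟩ := exists_continuousMap_orderRealization (Q := Q) (Y := Q)
    (fun n v ↦ ⟨fun t ↦ v (first n t), continuous_top⟩) (by
      intro m n φ v t
      refine congrArg v (huniq (stdSimplex.map φ t) ⟨stdSimplex_map_pos φ t (hfirst m t).1, ?_⟩
        (hfirst n _))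
      intro j hj
      rw [stdSimplex_map_apply]
      refine Finset.sum_eq_zero fun i hi ↦ (hfirst m t).2 i ?_
      rw [Finset.mem_filter] at hi
      by_contra! hle
      exact absurd (φ.monotone hle) (not_le.2 (hi.2 ▸ hj)))
  refine ⟨K, fun n v t k hk hk' ↦ ?_⟩
  rw [hK]
  exact congrArg v (huniq t (hfirst n t) ⟨hk, hk'⟩)

end OrderNerve

/-! ### Partial maps with open domain, as total maps to `Option Y`. -/

/-- The topology on `Option Y` whose open sets are the open sets of `Y` and the whole space. -/
@[reducible]
def closedPointTopology (Y : Type*) [TopologicalSpace Y] : TopologicalSpace (Option Y) where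
  IsOpen s := IsOpen (some ⁻¹' s) ∧ (none ∈ s → s = Set.univ)
  isOpen_univ := ⟨isOpen_univ, fun _ ↦ rfl⟩
  isOpen_inter s t hs ht := ⟨hs.1.inter ht.1, fun h ↦ by
    rw [hs.2 h.1, ht.2 h.2, Set.univ_inter]⟩
  isOpen_sUnion S hS := by
    refine ⟨?_, ?_⟩
    · rw [Set.preimage_sUnion]
      exact isOpen_biUnion fun s hs ↦ (hS s hs).1
    · rintro ⟨s, hs, h⟩
      rw [Set.eq_univ_iff_forall]
      intro x
      exact ⟨s, hs, (hS s hs).2 h ▸ Set.mem_univ x⟩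

theorem isEmbedding_some_closedPointTopology (Y : Type*) [TopologicalSpace Y] :
    @Topology.IsEmbedding _ _ _ (closedPointTopology Y) (some : Y → Option Y) := by
  let _ := closedPointTopology Y
  refine ⟨⟨?_⟩, Option.some_injective Y⟩
  ext s
  rw [isOpen_induced_iff]
  constructor
  · intro hs
    refine ⟨some '' s, ⟨?_, ?_⟩, ?_⟩
    · rwa [Set.preimage_image_eq _ (Option.some_injective Y)]
    · rintro ⟨x, -, h⟩
      cases h
    · rw [Set.preimage_image_eq _ (Option.some_injective Y)]
  · rintro ⟨t, ht, rfl⟩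
    exact ht.1

/-- The only open set containing `none` is the whole space, so no condition arises near the points
sent to `none`. -/
theorem continuous_closedPointTopology {X Y : Type*} [TopologicalSpace X] [TopologicalSpace Y]
    {f : X → Option Y} (h : ∀ V : Set Y, IsOpen V → IsOpen {x | ∃ y ∈ V, f x = some y}) :
    @Continuous _ _ _ (closedPointTopology Y) f := by
  let _ := closedPointTopology Y
  refine ⟨fun s hs ↦ ?_⟩
  by_cases hn : none ∈ s
  · rw [hs.2 hn]
    exact isOpen_univ
  · convert h _ hs.1 using 1
    ext x
    constructor
    · intro hx
      cases hfx : f x with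
      | none => exact absurd (hfx ▸ hx) hn
      | some y => exact ⟨y, by simpa [hfx] using hx, hfx⟩
    · rintro ⟨y, hy, hfx⟩
      simpa [hfx] using hy

/-! ### Projection of a simplex to a face, by restricting and rescaling the coordinates. -/

section Restrict

variable {X : Type*} [Fintype X]

open scoped Classical in
/-- The total weight of the vertices satisfying `p`. -/
def weight (p : X → Prop) (t : stdSimplex ℝ X) : ℝ := ∑ x with p x, t x

theorem weight_map {Y : Type*} [Fintype Y] (f : X → Y) (p : Y → Prop) (t : stdSimplex ℝ X) :
    weight p (stdSimplex.map f t) = weight (p ∘ f) t := by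
  classical
  exact stdSimplex_sum_map f t p

theorem weight_nonneg (p : X → Prop) (t : stdSimplex ℝ X) : 0 ≤ weight p t :=
  Finset.sum_nonneg fun x _ ↦ stdSimplex.zero_le t x

theorem continuous_weight (p : X → Prop) : Continuous (weight p) :=
  continuous_finsetSum _ fun x _ ↦ stdSimplex_continuous_apply x

open scoped Classical in
/-- The restriction of `t` to the vertices satisfying `p`, rescaled to total weight `1`. -/
def rescale (p : X → Prop) (t : stdSimplex ℝ X) (h : weight p t ≠ 0) : stdSimplex ℝ X :=
  ⟨fun x ↦ (if p x then t x else 0) / weight p t, fun x ↦ by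
    refine div_nonneg ?_ (weight_nonneg p t)
    split_ifs
    exacts [stdSimplex.zero_le t x, le_rfl], by
    rw [← Finset.sum_div, ← Finset.sum_filter]
    exact div_self h⟩

open scoped Classical in
theorem rescale_apply (p : X → Prop) (t : stdSimplex ℝ X) (h : weight p t ≠ 0) (x : X) :
    rescale p t h x = (if p x then t x else 0) / weight p t := rfl

theorem prop_of_rescale_pos {p : X → Prop} {t : stdSimplex ℝ X} {h : weight p t ≠ 0} {x : X}
    (hx : 0 < rescale p t h x) : p x := by
  by_contra hp
  simp [rescale_apply, hp] at hx

theorem weight_eq_one {p : X → Prop} (t : stdSimplex ℝ X) (hp : ∀ x, p x) : weight p t = 1 := by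
  simp [weight, hp]

theorem rescale_of_forall {p : X → Prop} (t : stdSimplex ℝ X) (h : weight p t ≠ 0)
    (hp : ∀ x, p x) : rescale p t h = t := by
  ext x
  simp [rescale_apply, hp, weight_eq_one t hp]

theorem map_rescale {Y : Type*} [Fintype Y] (f : X → Y) (p : Y → Prop) (t : stdSimplex ℝ X)
    (h : weight (p ∘ f) t ≠ 0) :
    stdSimplex.map f (rescale (p ∘ f) t h) =
      rescale p (stdSimplex.map f t) (by rwa [weight_map]) := by
  classical
  ext y
  rw [rescale_apply, weight_map, stdSimplex_map_apply]
  simp only [rescale_apply, ← Finset.sum_div, Function.comp]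
  congr 1
  rw [stdSimplex_map_apply]
  by_cases hy : p y
  · rw [if_pos hy]
    refine Finset.sum_congr rfl fun x hx ↦ ?_
    rw [if_pos ((Finset.mem_filter.1 hx).2 ▸ hy)]
  · rw [if_neg hy]
    refine Finset.sum_eq_zero fun x hx ↦ if_neg ?_
    rwa [(Finset.mem_filter.1 hx).2]

theorem continuous_rescale (p : X → Prop) :
    Continuous fun t : {t : stdSimplex ℝ X // weight p t ≠ 0} ↦ rescale p t.1 t.2 := by
  classical
  refine Continuous.subtype_mk (continuous_pi fun x ↦ Continuous.div ?_
    ((continuous_weight p).comp continuous_subtype_val) fun t ↦ t.2) _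
  split_ifs
  · exact (stdSimplex_continuous_apply x).comp continuous_subtype_val
  · exact continuous_const

theorem exists_of_weight_ne_zero {p : X → Prop} {t : stdSimplex ℝ X} (h : weight p t ≠ 0) :
    ∃ x, p x := by
  by_contra! hp
  simp [weight, hp] at h

end Restrict

/-! ### The realization of an upper set as a subspace. -/

section UpperSet

variable {Q : Type w} [Preorder Q] {U : Set Q}

/-- A chain that meets an upper set agrees, on that upper set, with a chain in the upper set. -/
theorem exists_chain_upperSet (hU : IsUpperSet U) {n : ℕ} (v : Fin (n + 1) →o Q)
    (h : ∃ j, v j ∈ U) : ∃ v' : Fin (n + 1) →o U, ∀ j, v j ∈ U → (v' j : Q) = v j := by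
  -- `k` is the first index whose vertex lies in `U`; the vertices before it are replaced by `v k`.
  obtain ⟨k, hk, hmin⟩ := WellFounded.has_min (wellFounded_lt (α := Fin (n + 1))) {k | v k ∈ U} h
  refine ⟨⟨fun j ↦ ⟨v (max j k), hU (v.monotone (le_max_right j k)) hk⟩,
    fun i j hij ↦ v.monotone (max_le_max_right k hij)⟩, fun j hj ↦ congrArg v ?_⟩
  exact max_eq_left (not_lt.1 (hmin j hj))

/-- The inclusion of an upper set, as a monotone map. -/
def upperInclusion (U : Set Q) : U →o Q := ⟨Subtype.val, fun _ _ h ↦ h⟩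

/-- On the points with positive total weight in `U`, dropping the other vertices and rescaling
defines a continuous partial map back to the realization of `U`. Extended by `none`, it is a left
inverse up to the embedding `some`, which forces the inclusion to be an embedding. -/
theorem isEmbedding_upperInclusion (hU : IsUpperSet U) :
    Topology.IsEmbedding (orderRealizationMap (upperInclusion U)) := by
  classical
  let _ : TopologicalSpace (Option (OrderRealization U)) := closedPointTopology _
  -- The chain in `U` is chosen arbitrarily. By `r_some` the choice does not matter, because after
  -- rescaling only vertices in `U` have positive weight.
  let r (n : ℕ) (v : Fin (n + 1) →o Q) (t : stdSimplex ℝ (Fin (n + 1))) :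
      Option (OrderRealization U) :=
    if h : weight (fun j ↦ v j ∈ U) t ≠ 0 then
      some (chainPoint (exists_chain_upperSet hU v (exists_of_weight_ne_zero h)).choose
        (rescale _ t h)) else none
  have r_some (n : ℕ) (v : Fin (n + 1) →o Q) (v' : Fin (n + 1) →o U)
      (hv' : ∀ j, v j ∈ U → (v' j : Q) = v j) (t : stdSimplex ℝ (Fin (n + 1)))
      (h : weight (fun j ↦ v j ∈ U) t ≠ 0) : r n v t = some (chainPoint v' (rescale _ t h)) := by
    refine (dif_pos h).trans (congrArg some (chainPoint_congr _ fun j hj ↦ Subtype.ext ?_))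
    have hj' : v j ∈ U := prop_of_rescale_pos (p := fun j ↦ v j ∈ U) hj
    rw [hv' j hj']
    exact (exists_chain_upperSet hU v (exists_of_weight_ne_zero h)).choose_spec j hj'
  have r_none (n : ℕ) (v : Fin (n + 1) →o Q) (t : stdSimplex ℝ (Fin (n + 1)))
      (h : weight (fun j ↦ v j ∈ U) t = 0) : r n v t = none := dif_neg (not_not.2 h)
  have hr (n : ℕ) (v : Fin (n + 1) →o Q) : Continuous (r n v) := by
    refine continuous_closedPointTopology fun V hV ↦ ?_
    by_cases hv : ∃ j, v j ∈ U
    · obtain ⟨v', hv'⟩ := exists_chain_upperSet hU v hv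
      have hW : IsOpen {t | weight (fun j ↦ v j ∈ U) t ≠ 0} :=
        isOpen_ne_fun (continuous_weight _) continuous_const
      have hc := hV.preimage ((chainPoint v').continuous.comp
        (continuous_rescale fun j ↦ v j ∈ U))
      convert hW.isOpenMap_subtype_val _ hc using 1
      ext t
      constructor
      · rintro ⟨y, hy, h⟩
        by_cases ht : weight (fun j ↦ v j ∈ U) t = 0
        · rw [r_none n v t ht] at h
          cases h
        · refine ⟨⟨t, ht⟩, ?_, rfl⟩
          rw [r_some n v v' hv' t ht, Option.some.injEq] at h
          rw [← h] at hy
          exact hy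
      · rintro ⟨⟨t, ht⟩, h, rfl⟩
        exact ⟨_, h, r_some n v v' hv' t ht⟩
    · convert isOpen_empty
      rw [Set.eq_empty_iff_forall_notMem]
      rintro t ⟨y, -, h⟩
      rw [r_none n v t (by_contra fun ht ↦ hv (exists_of_weight_ne_zero ht))] at h
      cases h
  obtain ⟨K, hK⟩ := exists_continuousMap_orderRealization (fun n v ↦ ⟨r n v, hr n v⟩) (by
    intro m n φ v t
    change r m (v.comp φ) t = r n v (stdSimplex.map φ t)
    have hw := weight_map φ (fun j ↦ v j ∈ U) t
    by_cases ht : weight (fun j ↦ v j ∈ U) (stdSimplex.map φ t) = 0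
    · rw [r_none n v _ ht, r_none m _ t (hw.symm.trans ht)]
    · obtain ⟨v', hv'⟩ := exists_chain_upperSet hU v (exists_of_weight_ne_zero ht)
      have ht' : weight (fun j ↦ (v.comp φ) j ∈ U) t ≠ 0 := fun h ↦ ht (hw.trans h)
      rw [r_some n v v' hv' _ ht, r_some m (v.comp φ) (v'.comp φ) (fun j hj ↦ hv' (φ j) hj) t ht',
        Option.some.injEq, chainPoint_comp]
      exact congrArg _ (map_rescale φ (fun j ↦ v j ∈ U) t ht'))
  refine Topology.IsEmbedding.of_comp (ContinuousMap.continuous _) K.continuous ?_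
  convert isEmbedding_some_closedPointTopology (OrderRealization U) using 1
  funext x
  obtain ⟨n, v, t, rfl⟩ := exists_chainPoint x
  rw [Function.comp, orderRealizationMap_chainPoint, hK]
  have hv (j) : ((upperInclusion U).comp v) j ∈ U := (v j).2
  have ht : weight (fun j ↦ ((upperInclusion U).comp v) j ∈ U) t ≠ 0 := by
    rw [weight_eq_one t hv]
    exact one_ne_zero
  change r n _ t = _
  rw [r_some n _ v (fun _ _ ↦ rfl) t ht, rescale_of_forall t ht hv]

/-- A point of the realization, given by a chain, lies in the realization of an upper set as soon
as the first vertex of positive weight lies in the upper set. -/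
theorem mem_range_upperInclusion (hU : IsUpperSet U) {n : ℕ} (v : Fin (n + 1) →o Q)
    (t : stdSimplex ℝ (Fin (n + 1))) {k : Fin (n + 1)} (ht : ∀ j < k, t j = 0) (hk : v k ∈ U) :
    chainPoint v t ∈ Set.range (orderRealizationMap (upperInclusion U)) := by
  obtain ⟨v', hv'⟩ := exists_chain_upperSet hU v ⟨k, hk⟩
  refine ⟨chainPoint v' t, ?_⟩
  rw [orderRealizationMap_chainPoint]
  refine chainPoint_congr t fun j hj ↦ hv' j (hU (v.monotone (not_lt.1 fun h ↦ ?_)) hk)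
  exact hj.ne' (ht j h)

end UpperSet

/-! ### Cutting the unit interval, subdivided by barycentric coordinates, at a point. -/

section Cut

open Finset

variable {n : ℕ}

/-- The length of the intersection with `[0, s]` of the `j`-th interval of the subdivision of
`[0, 1]` into intervals of lengths `t₀, …, tₙ`. -/
def cutWeight (t : stdSimplex ℝ (Fin (n + 1))) (s : ℝ) (j : Fin (n + 1)) : ℝ :=
  min (∑ i ∈ Iic j, t i) s - min (∑ i ∈ Iio j, t i) s

theorem sum_Iic_eq (t : stdSimplex ℝ (Fin (n + 1))) (j : Fin (n + 1)) :
    ∑ i ∈ Iic j, t i = ∑ i ∈ Iio j, t i + t j := by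
  rw [← Finset.Iio_insert, Finset.sum_insert (by simp), add_comm]

theorem cutWeight_nonneg (t : stdSimplex ℝ (Fin (n + 1))) (s : ℝ) (j : Fin (n + 1)) :
    0 ≤ cutWeight t s j := by
  have := stdSimplex.zero_le t j
  rw [cutWeight, sum_Iic_eq, sub_nonneg]
  exact min_le_min_right s (by linarith)

theorem cutWeight_le (t : stdSimplex ℝ (Fin (n + 1))) (s : ℝ) (j : Fin (n + 1)) :
    cutWeight t s j ≤ t j := by
  have := stdSimplex.zero_le t j
  rw [cutWeight, sum_Iic_eq]
  rcases le_total (∑ i ∈ Iio j, t i) s with h | h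
  · rw [min_eq_left h]
    linarith [min_le_left (∑ i ∈ Iio j, t i + t j) s]
  · rw [min_eq_right h]
    linarith [min_le_right (∑ i ∈ Iio j, t i + t j) s]

/-- The differences defining `cutWeight` telescope along an initial segment. -/
theorem sum_cutWeight (t : stdSimplex ℝ (Fin (n + 1))) {s : ℝ} (hs : 0 ≤ s)
    (L : Finset (Fin (n + 1))) :
    IsLowerSet (L : Set (Fin (n + 1))) → ∑ j ∈ L, cutWeight t s j = min (∑ j ∈ L, t j) s := by
  induction L using Finset.induction_on_max with
  | empty => simp [hs]
  | insert a L ha ih =>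
    intro hL
    have ha' : a ∉ L := fun h ↦ lt_irrefl a (ha a h)
    have hLa : L = Iio a := by
      ext x
      rw [mem_Iio]
      refine ⟨ha x, fun hx ↦ ?_⟩
      have : x ∈ insert a L := hL hx.le (mem_insert_self a L)
      exact (mem_insert.1 this).resolve_left hx.ne
    have hlow : IsLowerSet (L : Set (Fin (n + 1))) := by
      rw [hLa, coe_Iio]
      exact isLowerSet_Iio a
    rw [sum_insert ha', ih hlow, hLa, Finset.Iio_insert, cutWeight]
    ring

/-- For monotone `φ` the fibre over `k` is the difference of the initial segments `φ j ≤ k` and `φ j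
< k`: pushing forward along `φ` merges adjacent intervals, which commutes with cutting at `s`. -/
theorem sum_cutWeight_map {m : ℕ} (φ : Fin (m + 1) →o Fin (n + 1))
    (t : stdSimplex ℝ (Fin (m + 1))) {s : ℝ} (hs : 0 ≤ s) (k : Fin (n + 1)) :
    ∑ j with φ j = k, cutWeight t s j = cutWeight (stdSimplex.map φ t) s k := by
  have hle : ∑ j with φ j ≤ k, cutWeight t s j = min (∑ i ∈ Iic k, stdSimplex.map φ t i) s := by
    rw [sum_cutWeight t hs, ← filter_ge_eq_Iic, stdSimplex_sum_map]
    intro a b hba ha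
    simp only [coe_filter, mem_univ, true_and, Set.mem_ofPred_eq] at ha ⊢
    exact (φ.monotone hba).trans ha
  have hlt : ∑ j with φ j < k, cutWeight t s j = min (∑ i ∈ Iio k, stdSimplex.map φ t i) s := by
    rw [sum_cutWeight t hs, ← filter_gt_eq_Iio, stdSimplex_sum_map]
    intro a b hba ha
    simp only [coe_filter, mem_univ, true_and, Set.mem_ofPred_eq] at ha ⊢
    exact (φ.monotone hba).trans_lt ha
  rw [cutWeight, ← hle, ← hlt, eq_sub_iff_add_eq, ← sum_union]
  · congr 1
    ext j
    simp [le_iff_eq_or_lt]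
  · rw [disjoint_filter]
    intro j _ h
    exact h.not_lt

theorem continuous_cutWeight (j : Fin (n + 1)) :
    Continuous fun x : stdSimplex ℝ (Fin (n + 1)) × unitInterval ↦ cutWeight x.1 x.2 j := by
  have h (L : Finset (Fin (n + 1))) :
      Continuous fun x : stdSimplex ℝ (Fin (n + 1)) × unitInterval ↦ min (∑ i ∈ L, x.1 i) x.2 :=
    (continuous_finsetSum _ fun i _ ↦ (stdSimplex_continuous_apply i).comp continuous_fst).min
      (continuous_subtype_val.comp continuous_snd)
  exact (h _).sub (h _)

/-- The subdivision of `[0, 1]` into the intersections of the intervals of lengths `t₀, …, tₙ` with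
`[0, s]` and with `[s, 1]`. -/
def cutSimplex (t : stdSimplex ℝ (Fin (n + 1))) (s : unitInterval) :
    stdSimplex ℝ (Fin (n + 1) ⊕ Fin (n + 1)) :=
  ⟨Sum.elim (cutWeight t s) fun j ↦ t j - cutWeight t s j, by
    rintro (j | j)
    · exact cutWeight_nonneg t s j
    · exact sub_nonneg.2 (cutWeight_le t s j), by
    rw [Fintype.sum_sum_type]
    simp [sum_sub_distrib]⟩

@[simp]
theorem cutSimplex_inl (t : stdSimplex ℝ (Fin (n + 1))) (s : unitInterval) (j : Fin (n + 1)) :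
    cutSimplex t s (Sum.inl j) = cutWeight t s j := rfl

@[simp]
theorem cutSimplex_inr (t : stdSimplex ℝ (Fin (n + 1))) (s : unitInterval) (j : Fin (n + 1)) :
    cutSimplex t s (Sum.inr j) = t j - cutWeight t s j := rfl

theorem continuous_cutSimplex :
    Continuous fun x : stdSimplex ℝ (Fin (n + 1)) × unitInterval ↦ cutSimplex x.1 x.2 := by
  refine Continuous.subtype_mk (continuous_pi ?_) _
  rintro (j | j)
  · exact continuous_cutWeight j
  · exact ((stdSimplex_continuous_apply j).comp continuous_fst).sub (continuous_cutWeight j)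

theorem map_cutSimplex {m : ℕ} (φ : Fin (m + 1) →o Fin (n + 1))
    (t : stdSimplex ℝ (Fin (m + 1))) (s : unitInterval) :
    stdSimplex.map (Sum.map φ φ) (cutSimplex t s) = cutSimplex (stdSimplex.map φ t) s := by
  ext (k | k)
  · rw [stdSimplex_map_apply, cutSimplex_inl, ← sum_cutWeight_map φ t s.2.1, sum_filter,
      Fintype.sum_sum_type, sum_filter]
    simp
  · rw [stdSimplex_map_apply, cutSimplex_inr, ← sum_cutWeight_map φ t s.2.1, sum_filter,
      Fintype.sum_sum_type, stdSimplex_map_apply, ← sum_sub_distrib, sum_filter]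
    simp

theorem cutSimplex_zero (t : stdSimplex ℝ (Fin (n + 1))) :
    cutSimplex t 0 = stdSimplex.map Sum.inr t := by
  have h (j) : cutWeight t 0 j = 0 := by
    have h0 (L : Finset (Fin (n + 1))) : 0 ≤ ∑ i ∈ L, t i :=
      sum_nonneg fun i _ ↦ stdSimplex.zero_le t i
    rw [cutWeight, min_eq_right (h0 _), min_eq_right (h0 _), sub_self]
  ext (k | k)
  · rw [stdSimplex_map_apply, cutSimplex_inl]
    simp [h]
  · rw [stdSimplex_map_apply, cutSimplex_inr]
    simp [h, sum_filter]

theorem cutSimplex_one (t : stdSimplex ℝ (Fin (n + 1))) :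
    cutSimplex t 1 = stdSimplex.map Sum.inl t := by
  have h (j) : cutWeight t 1 j = t j := by
    have h1 (L : Finset (Fin (n + 1))) : ∑ i ∈ L, t i ≤ 1 := by
      rw [← stdSimplex.sum_eq_one t]
      exact sum_le_univ_sum_of_nonneg fun i ↦ stdSimplex.zero_le t i
    rw [cutWeight, min_eq_left (h1 _), min_eq_left (h1 _), sum_Iic_eq, add_sub_cancel_left]
  ext (k | k)
  · rw [stdSimplex_map_apply, cutSimplex_inl]
    simp [h, sum_filter]
  · rw [stdSimplex_map_apply, cutSimplex_inr]
    simp [h]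

/-- The point `s` lies in the `k`-th interval. -/
def IsCut (t : stdSimplex ℝ (Fin (n + 1))) (s : ℝ) (k : Fin (n + 1)) : Prop :=
  ∑ i ∈ Iio k, t i ≤ s ∧ s ≤ ∑ i ∈ Iic k, t i

theorem exists_isCut (t : stdSimplex ℝ (Fin (n + 1))) (s : unitInterval) : ∃ k, IsCut t s k := by
  -- The first interval whose right end reaches `s`: its left end is either `0` or the right end of
  -- the preceding interval, which does not reach `s`.
  obtain ⟨k, hk, hmin⟩ := WellFounded.has_min (wellFounded_lt (α := Fin (n + 1)))
    {k | (s : ℝ) ≤ ∑ i ∈ Iic k, t i} ⟨Fin.last n, by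
      have : Iic (Fin.last n) = univ := by
        ext x
        simp [Fin.le_last]
      rw [Set.mem_ofPred_eq, this, stdSimplex.sum_eq_one]
      exact s.2.2⟩
  refine ⟨k, ?_, hk⟩
  induction k using Fin.cases with
  | zero =>
    have : Iio (0 : Fin (n + 1)) = ∅ := by
      ext x
      simp
    rw [this, sum_empty]
    exact s.2.1
  | succ k =>
    have : Iio k.succ = Iic k.castSucc := by
      ext x
      simp [Fin.lt_def, Fin.le_def]
    rw [this]
    exact (not_le.1 fun h ↦ hmin _ h Fin.castSucc_lt_succ).le

theorem isClosed_isCut (k : Fin (n + 1)) :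
    IsClosed {x : stdSimplex ℝ (Fin (n + 1)) × unitInterval | IsCut x.1 x.2 k} := by
  have h (L : Finset (Fin (n + 1))) :
      Continuous fun x : stdSimplex ℝ (Fin (n + 1)) × unitInterval ↦ ∑ i ∈ L, x.1 i :=
    continuous_finsetSum _ fun i _ ↦ (stdSimplex_continuous_apply i).comp continuous_fst
  have hs : Continuous fun x : stdSimplex ℝ (Fin (n + 1)) × unitInterval ↦ (x.2 : ℝ) :=
    continuous_subtype_val.comp continuous_snd
  exact (isClosed_le (h _) hs).inter (isClosed_le hs (h _))

theorem sum_mono_set (t : stdSimplex ℝ (Fin (n + 1))) {A B : Finset (Fin (n + 1))} (h : A ⊆ B) :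
    ∑ i ∈ A, t i ≤ ∑ i ∈ B, t i :=
  sum_le_sum_of_subset_of_nonneg h fun i _ _ ↦ stdSimplex.zero_le t i

theorem IsCut.map {m : ℕ} {t : stdSimplex ℝ (Fin (m + 1))} {s : ℝ} {k : Fin (m + 1)}
    (h : IsCut t s k) (φ : Fin (m + 1) →o Fin (n + 1)) : IsCut (stdSimplex.map φ t) s (φ k) := by
  rw [IsCut, ← filter_gt_eq_Iio, ← filter_ge_eq_Iic, stdSimplex_sum_map, stdSimplex_sum_map]
  refine ⟨(sum_mono_set t fun j hj ↦ ?_).trans h.1, h.2.trans (sum_mono_set t fun j hj ↦ ?_)⟩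
  · rw [mem_filter] at hj
    exact mem_Iio.2 (not_le.1 fun hle ↦ absurd (φ.monotone hle) hj.2.not_ge)
  · exact mem_filter.2 ⟨mem_univ _, φ.monotone (mem_Iic.1 hj)⟩

theorem IsCut.le_of_inl_pos {t : stdSimplex ℝ (Fin (n + 1))} {s : ℝ} {k j : Fin (n + 1)}
    (h : IsCut t s k) (hj : 0 < cutWeight t s j) : j ≤ k := by
  by_contra! hkj
  have h1 : s ≤ ∑ i ∈ Iio j, t i :=
    h.2.trans (sum_mono_set t fun i hi ↦ mem_Iio.2 ((mem_Iic.1 hi).trans_lt hkj))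
  have h2 : s ≤ ∑ i ∈ Iic j, t i := h1.trans (sum_mono_set t Iio_subset_Iic_self)
  rw [cutWeight, min_eq_right h1, min_eq_right h2, sub_self] at hj
  exact lt_irrefl _ hj

theorem IsCut.le_of_inr_pos {t : stdSimplex ℝ (Fin (n + 1))} {s : ℝ} {k j : Fin (n + 1)}
    (h : IsCut t s k) (hj : 0 < t j - cutWeight t s j) : k ≤ j := by
  by_contra! hjk
  have h2 : ∑ i ∈ Iic j, t i ≤ s :=
    (sum_mono_set t fun i hi ↦ mem_Iio.2 ((mem_Iic.1 hi).trans_lt hjk)).trans h.1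
  have h1 : ∑ i ∈ Iio j, t i ≤ s := (sum_mono_set t Iio_subset_Iic_self).trans h2
  rw [cutWeight, min_eq_left h1, min_eq_left h2, sum_Iic_eq] at hj
  linarith

end Cut

/-! ### The prism homotopy between comparable monotone maps. -/

section Homotopy

variable {Q Q' : Type w} [Preorder Q] [Preorder Q']

/-- Two copies of `[n]`, one after the other, as an initial segment. -/
def sumFin (n : ℕ) : Fin (n + 1) ⊕ Fin (n + 1) ≃ Fin (n + 1 + n + 1) := finSumFinEquiv

theorem sumFin_inl_le_inl {n : ℕ} {i j : Fin (n + 1)} :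
    sumFin n (Sum.inl i) ≤ sumFin n (Sum.inl j) ↔ i ≤ j := Iff.rfl

theorem sumFin_inr_le_inr {n : ℕ} {i j : Fin (n + 1)} :
    sumFin n (Sum.inr i) ≤ sumFin n (Sum.inr j) ↔ i ≤ j :=
  Nat.add_le_add_iff_left (n := n + 1)

theorem sumFin_inl_lt_inr {n : ℕ} (i j : Fin (n + 1)) :
    sumFin n (Sum.inl i) < sumFin n (Sum.inr j) :=
  Fin.lt_def.2 (lt_of_lt_of_le i.isLt (Nat.le_add_right (n + 1) j))

/-- A map out of two copies of `[n]` is monotone if it is so on each copy and the values on the first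
copy are bounded by those on the second. -/
def sumFinHom {α : Type*} [Preorder α] {n : ℕ} (f g : Fin (n + 1) →o α) (h : ∀ i j, f i ≤ g j) :
    Fin (n + 1 + n + 1) →o α where
  toFun i := Sum.elim f g ((sumFin n).symm i)
  monotone' i i' hi := by
    obtain ⟨x, rfl⟩ := (sumFin n).surjective i
    obtain ⟨x', rfl⟩ := (sumFin n).surjective i'
    simp only [Equiv.symm_apply_apply]
    rcases x with j | j <;> rcases x' with j' | j'
    · exact f.monotone (sumFin_inl_le_inl.1 hi)
    · exact h j j'
    · exact absurd (sumFin_inl_lt_inr j' j) hi.not_gt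
    · exact g.monotone (sumFin_inr_le_inr.1 hi)

theorem sumFinHom_inl {α : Type*} [Preorder α] {n : ℕ} (f g : Fin (n + 1) →o α)
    (h : ∀ i j, f i ≤ g j) (j : Fin (n + 1)) : sumFinHom f g h (sumFin n (Sum.inl j)) = f j :=
  congrArg (Sum.elim f g) ((sumFin n).symm_apply_apply _)

theorem sumFinHom_inr {α : Type*} [Preorder α] {n : ℕ} (f g : Fin (n + 1) →o α)
    (h : ∀ i j, f i ≤ g j) (j : Fin (n + 1)) : sumFinHom f g h (sumFin n (Sum.inr j)) = g j :=
  congrArg (Sum.elim f g) ((sumFin n).symm_apply_apply _)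

/-- The chain `h₀ v₀ ≤ ⋯ ≤ h₀ vₖ ≤ h₁ vₖ ≤ ⋯ ≤ h₁ vₙ`, indexed with repetitions by two copies
of `[n]`. -/
def prismChain {h₀ h₁ : Q →o Q'} (hle : ∀ x, h₀ x ≤ h₁ x) {n : ℕ} (v : Fin (n + 1) →o Q)
    (k : Fin (n + 1)) : Fin (n + 1 + n + 1) →o Q' :=
  sumFinHom ⟨fun j ↦ h₀ (v (min j k)), fun _ _ h ↦ h₀.monotone (v.monotone (min_le_min_right k h))⟩
    ⟨fun j ↦ h₁ (v (max j k)), fun _ _ h ↦ h₁.monotone (v.monotone (max_le_max_right k h))⟩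
    fun _ _ ↦ (hle _).trans
      (h₁.monotone (v.monotone ((min_le_right _ _).trans (le_max_right _ _))))

theorem prismChain_inl {h₀ h₁ : Q →o Q'} (hle : ∀ x, h₀ x ≤ h₁ x) {n : ℕ} (v : Fin (n + 1) →o Q)
    (k j : Fin (n + 1)) : prismChain hle v k (sumFin n (Sum.inl j)) = h₀ (v (min j k)) :=
  sumFinHom_inl _ _ _ j

theorem prismChain_inr {h₀ h₁ : Q →o Q'} (hle : ∀ x, h₀ x ≤ h₁ x) {n : ℕ} (v : Fin (n + 1) →o Q)
    (k j : Fin (n + 1)) : prismChain hle v k (sumFin n (Sum.inr j)) = h₁ (v (max j k)) :=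
  sumFinHom_inr _ _ _ j

/-- The image of `cutSimplex` in a standard simplex indexed by an initial segment. -/
def cutSimplexFin {n : ℕ} (t : stdSimplex ℝ (Fin (n + 1))) (s : unitInterval) :
    stdSimplex ℝ (Fin (n + 1 + n + 1)) :=
  stdSimplex.map (sumFin n) (cutSimplex t s)

theorem continuous_cutSimplexFin {n : ℕ} :
    Continuous fun x : stdSimplex ℝ (Fin (n + 1)) × unitInterval ↦ cutSimplexFin x.1 x.2 :=
  (stdSimplex.continuous_map _).comp continuous_cutSimplex

theorem cutSimplexFin_apply {n : ℕ} (t : stdSimplex ℝ (Fin (n + 1))) (s : unitInterval)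
    (x : Fin (n + 1) ⊕ Fin (n + 1)) :
    cutSimplexFin t s (sumFin n x) = cutSimplex t s x := by
  classical
  rw [cutSimplexFin, stdSimplex_map_apply]
  simp only [EmbeddingLike.apply_eq_iff_eq]
  rw [Finset.sum_filter]
  simp

/-- The two copies of `φ : [m] → [n]`. -/
def doubleHom {m n : ℕ} (φ : Fin (m + 1) →o Fin (n + 1)) :
    Fin (m + 1 + m + 1) →o Fin (n + 1 + n + 1) :=
  sumFinHom ⟨fun j ↦ sumFin n (Sum.inl (φ j)), fun _ _ h ↦ sumFin_inl_le_inl.2 (φ.monotone h)⟩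
    ⟨fun j ↦ sumFin n (Sum.inr (φ j)), fun _ _ h ↦ sumFin_inr_le_inr.2 (φ.monotone h)⟩
    fun _ _ ↦ (sumFin_inl_lt_inr _ _).le

theorem doubleHom_sumFin {m n : ℕ} (φ : Fin (m + 1) →o Fin (n + 1))
    (x : Fin (m + 1) ⊕ Fin (m + 1)) :
    doubleHom φ (sumFin m x) = sumFin n (Sum.map φ φ x) := by
  rcases x with j | j
  · exact sumFinHom_inl _ _ _ j
  · exact sumFinHom_inr _ _ _ j

theorem map_cutSimplexFin {m n : ℕ} (φ : Fin (m + 1) →o Fin (n + 1))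
    (t : stdSimplex ℝ (Fin (m + 1))) (s : unitInterval) :
    stdSimplex.map (doubleHom φ) (cutSimplexFin t s) = cutSimplexFin (stdSimplex.map φ t) s := by
  rw [cutSimplexFin, cutSimplexFin, stdSimplex.map_comp_apply, ← map_cutSimplex,
    stdSimplex.map_comp_apply]
  congr 1
  funext x
  exact doubleHom_sumFin φ x

variable {h₀ h₁ : Q →o Q'} (hle : ∀ x, h₀ x ≤ h₁ x)

theorem prismChain_comp {m n : ℕ} (φ : Fin (m + 1) →o Fin (n + 1)) (v : Fin (n + 1) →o Q)
    (k : Fin (m + 1)) :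
    prismChain hle (v.comp φ) k = (prismChain hle v (φ k)).comp (doubleHom φ) := by
  ext i
  obtain ⟨x, rfl⟩ := (sumFin m).surjective i
  rw [OrderHom.comp_coe, Function.comp, doubleHom_sumFin]
  rcases x with j | j
  · rw [Sum.map_inl, prismChain_inl, prismChain_inl, OrderHom.comp_coe, Function.comp,
      φ.monotone.map_min]
  · rw [Sum.map_inr, prismChain_inr, prismChain_inr, OrderHom.comp_coe, Function.comp,
      φ.monotone.map_max]

/-- When `s` is an endpoint of several intervals the cut index is not unique. The chains then differ
only at vertices of weight zero: positive weight in the first copy forces `j ≤ k`, and in the second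
`k ≤ j`. -/
theorem chainPoint_prismChain_congr {n : ℕ} (v : Fin (n + 1) →o Q)
    (t : stdSimplex ℝ (Fin (n + 1))) (s : unitInterval) {k l : Fin (n + 1)} (hk : IsCut t s k)
    (hl : IsCut t s l) :
    chainPoint (prismChain hle v k) (cutSimplexFin t s) =
      chainPoint (prismChain hle v l) (cutSimplexFin t s) := by
  refine chainPoint_congr _ fun i hi ↦ ?_
  obtain ⟨x, rfl⟩ := (sumFin n).surjective i
  rw [cutSimplexFin_apply] at hi
  rcases x with j | j
  · rw [prismChain_inl, prismChain_inl, min_eq_left (hk.le_of_inl_pos hi),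
      min_eq_left (hl.le_of_inl_pos hi)]
  · rw [prismChain_inr, prismChain_inr, max_eq_left (hk.le_of_inr_pos hi),
      max_eq_left (hl.le_of_inr_pos hi)]

/-- The homotopy between the realizations of two comparable monotone maps, on a simplex. -/
def prismMap {n : ℕ} (v : Fin (n + 1) →o Q) (x : stdSimplex ℝ (Fin (n + 1)) × unitInterval) :
    OrderRealization Q' :=
  chainPoint (prismChain hle v (exists_isCut x.1 x.2).choose) (cutSimplexFin x.1 x.2)

theorem prismMap_eq {n : ℕ} (v : Fin (n + 1) →o Q) {t : stdSimplex ℝ (Fin (n + 1))}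
    {s : unitInterval} {k : Fin (n + 1)} (hk : IsCut t s k) :
    prismMap hle v (t, s) = chainPoint (prismChain hle v k) (cutSimplexFin t s) :=
  chainPoint_prismChain_congr hle v t s (exists_isCut t s).choose_spec hk

/-- The sets where `k` is a cut index form a finite closed cover of the prism, and on each of them
one fixed chain can be used. -/
theorem continuous_prismMap {n : ℕ} (v : Fin (n + 1) →o Q) : Continuous (prismMap hle v) := by
  refine LocallyFinite.continuous (locallyFinite_of_finite
    fun k : Fin (n + 1) ↦ {x : stdSimplex ℝ (Fin (n + 1)) × unitInterval | IsCut x.1 x.2 k}) ?_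
    isClosed_isCut fun k ↦ ?_
  · rw [Set.eq_univ_iff_forall]
    exact fun x ↦ Set.mem_iUnion.2 (exists_isCut x.1 x.2)
  · exact ((chainPoint (prismChain hle v k)).continuous.comp
      continuous_cutSimplexFin).continuousOn.congr fun x hx ↦ prismMap_eq hle v hx

theorem prismMap_comp {m n : ℕ} (φ : Fin (m + 1) →o Fin (n + 1)) (v : Fin (n + 1) →o Q)
    (t : stdSimplex ℝ (Fin (m + 1))) (s : unitInterval) :
    prismMap hle (v.comp φ) (t, s) = prismMap hle v (stdSimplex.map φ t, s) := by
  obtain ⟨k, hk⟩ := exists_isCut t s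
  rw [prismMap_eq hle _ hk, prismMap_eq hle _ (hk.map φ), prismChain_comp, chainPoint_comp,
    map_cutSimplexFin]

theorem prismMap_zero {n : ℕ} (v : Fin (n + 1) →o Q) (t : stdSimplex ℝ (Fin (n + 1))) :
    prismMap hle v (t, 0) = chainPoint (h₁.comp v) t := by
  -- At `s = 0` all weight lies in the second copy, and the cut index `0` makes the truncation `max
  -- j k` harmless; at `s = 1` the last index plays this role for `min j k`.
  have h0 : IsCut t ((0 : unitInterval) : ℝ) 0 := by
    refine ⟨?_, Finset.sum_nonneg fun i _ ↦ stdSimplex.zero_le t i⟩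
    have : Finset.Iio (0 : Fin (n + 1)) = ∅ := by
      ext x
      simp
    simp [this]
  let ι : Fin (n + 1) →o Fin (n + 1 + n + 1) :=
    ⟨fun j ↦ sumFin n (Sum.inr j), fun _ _ h ↦ sumFin_inr_le_inr.2 h⟩
  rw [prismMap_eq hle v h0, cutSimplexFin, cutSimplex_zero, stdSimplex.map_comp_apply]
  refine (chainPoint_comp _ ι t).symm.trans (congrArg (fun v ↦ chainPoint v t) ?_)
  ext j
  refine (prismChain_inr hle v 0 j).trans ?_
  rw [max_eq_left (Fin.zero_le j)]
  rfl

theorem prismMap_one {n : ℕ} (v : Fin (n + 1) →o Q) (t : stdSimplex ℝ (Fin (n + 1))) :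
    prismMap hle v (t, 1) = chainPoint (h₀.comp v) t := by
  have h1 : IsCut t ((1 : unitInterval) : ℝ) (Fin.last n) := by
    have : Finset.Iic (Fin.last n) = Finset.univ := by
      ext x
      simp [Fin.le_last]
    refine ⟨?_, ?_⟩
    · refine (sum_mono_set t (Finset.subset_univ _)).trans ?_
      rw [stdSimplex.sum_eq_one]
      exact le_rfl
    · rw [this, stdSimplex.sum_eq_one]
      exact le_rfl
  let ι : Fin (n + 1) →o Fin (n + 1 + n + 1) :=
    ⟨fun j ↦ sumFin n (Sum.inl j), fun _ _ h ↦ sumFin_inl_le_inl.2 h⟩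
  rw [prismMap_eq hle v h1, cutSimplexFin, cutSimplex_one, stdSimplex.map_comp_apply]
  refine (chainPoint_comp _ ι t).symm.trans (congrArg (fun v ↦ chainPoint v t) ?_)
  ext j
  refine (prismChain_inl hle v (Fin.last n) j).trans ?_
  rw [min_eq_left (Fin.le_last j)]
  rfl

/-- The cut index is chosen from the point of the prism alone, not from the chain `v`, so both sides
use the same one. -/
theorem orderRealizationMap_prismMap (a : Q →o Q) (b : Q' →o Q') (h0 : ∀ x, h₀ (a x) = b (h₀ x))
    (h1 : ∀ x, h₁ (a x) = b (h₁ x)) {n : ℕ} (v : Fin (n + 1) →o Q)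
    (x : stdSimplex ℝ (Fin (n + 1)) × unitInterval) :
    orderRealizationMap b (prismMap hle v x) = prismMap hle (a.comp v) x := by
  rw [prismMap, orderRealizationMap_chainPoint, prismMap]
  congr 2
  ext i
  obtain ⟨x, rfl⟩ := (sumFin n).surjective i
  rw [OrderHom.comp_coe, Function.comp]
  rcases x with j | j
  · rw [prismChain_inl, prismChain_inl]
    exact (h0 _).symm
  · rw [prismChain_inr, prismChain_inr]
    exact (h1 _).symm

/-- Comparable monotone maps have homotopic realizations, by a homotopy that is natural with respect
to the monotone maps which commute with them. -/
theorem exists_homotopy_of_le (hle : ∀ x, h₀ x ≤ h₁ x) :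
    ∃ H : ContinuousMap.Homotopy (orderRealizationMap h₁) (orderRealizationMap h₀),
      ∀ (a : Q →o Q) (b : Q' →o Q'), (∀ x, h₀ (a x) = b (h₀ x)) → (∀ x, h₁ (a x) = b (h₁ x)) →
        ∀ s x, H (s, orderRealizationMap a x) = orderRealizationMap b (H (s, x)) := by
  -- Gluing maps into the path space, instead of maps on a product with the interval, needs only the
  -- universal property of the realization.
  obtain ⟨K, hK⟩ := exists_continuousMap_orderRealization (Q := Q)
    (Y := C(unitInterval, OrderRealization Q'))
    (fun n v ↦ ContinuousMap.curry ⟨prismMap hle v, continuous_prismMap hle v⟩)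
    (fun m n φ v t ↦ ContinuousMap.ext fun s ↦ prismMap_comp hle φ v t s)
  have hK' {n : ℕ} (v : Fin (n + 1) →o Q) (t s) : K (chainPoint v t) s = prismMap hle v (t, s) :=
    DFunLike.congr_fun (hK n v t) s
  refine ⟨{ toContinuousMap := K.uncurry.comp ⟨Prod.swap, continuous_swap⟩
            map_zero_left := fun x ↦ ?_
            map_one_left := fun x ↦ ?_ }, fun a b h0 h1 s x ↦ ?_⟩
  · obtain ⟨n, v, t, rfl⟩ := exists_chainPoint x
    rw [orderRealizationMap_chainPoint]
    exact (hK' v t 0).trans (prismMap_zero hle v t)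
  · obtain ⟨n, v, t, rfl⟩ := exists_chainPoint x
    rw [orderRealizationMap_chainPoint]
    exact (hK' v t 1).trans (prismMap_one hle v t)
  · obtain ⟨n, v, t, rfl⟩ := exists_chainPoint x
    rw [orderRealizationMap_chainPoint]
    change K (chainPoint (a.comp v) t) s = orderRealizationMap b (K (chainPoint v t) s)
    rw [hK', hK', orderRealizationMap_prismMap hle a b h0 h1]

end Homotopy

/-! ### Homotopies that descend to quotient spaces. -/

section Quotient

variable {Y Z : Type*} [TopologicalSpace Y] [TopologicalSpace Z]

theorem contractibleSpace_of_homotopies {f : C(Y, Y)} {y₀ : Y}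
    (h₁ : (ContinuousMap.id Y).Homotopic f) (h₂ : (ContinuousMap.const Y y₀).Homotopic f) :
    ContractibleSpace Y :=
  (contractible_iff_id_nullhomotopic Y).2 ⟨y₀, h₁.trans h₂.symm⟩

/-- The map induced on a quotient by a continuous map compatible with the relation. -/
def quotientMapOf (r : Setoid Y) (f : C(Y, Y)) (hf : ∀ y y', r y y' → r (f y) (f y')) :
    C(Quotient r, Quotient r) where
  toFun := Quotient.map f hf
  continuous_toFun := (continuous_quotient_mk'.comp f.continuous).quotient_lift _

/-- A homotopy compatible with an equivalence relation descends to the quotient space. -/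
theorem homotopic_quotientMapOf (r : Setoid Y) {f g : C(Y, Y)} (H : f.Homotopy g)
    (hH : ∀ s y y', r y y' → r (H (s, y)) (H (s, y')))
    (hf : ∀ y y', r y y' → r (f y) (f y')) (hg : ∀ y y', r y y' → r (g y) (g y')) :
    (quotientMapOf r f hf).Homotopic (quotientMapOf r g hg) := by
  let q : C(Y, Quotient r) := ⟨Quotient.mk r, continuous_quotient_mk'⟩
  -- In curried form, continuity on the quotient follows from the universal property, with no need
  -- to know that the product of the quotient map with the interval is a quotient map.
  let K : C(Y, C(unitInterval, Quotient r)) :=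
    ((q.comp H.toContinuousMap).comp ⟨Prod.swap, continuous_swap⟩).curry
  let K' : C(Quotient r, C(unitInterval, Quotient r)) :=
    ⟨Quotient.lift K fun y y' h ↦ ContinuousMap.ext fun s ↦ Quotient.sound (hH s y y' h),
      K.continuous.quotient_lift _⟩
  refine ⟨{ toContinuousMap := K'.uncurry.comp ⟨Prod.swap, continuous_swap⟩
            map_zero_left := fun y ↦ ?_
            map_one_left := fun y ↦ ?_ }⟩
  · induction y using Quotient.inductionOn with
    | h y => exact congrArg (Quotient.mk r) (H.apply_zero y)
  · induction y using Quotient.inductionOn with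
    | h y => exact congrArg (Quotient.mk r) (H.apply_one y)

/-- If homotopies from the identity and from a constant map to a common map are compatible with an
equivalence relation, then the space and its quotient are contractible. -/
theorem contractibleSpace_and_quotient (r : Setoid Y) {f : C(Y, Y)} {y₀ : Y}
    (H₁ : (ContinuousMap.id Y).Homotopy f) (H₂ : (ContinuousMap.const Y y₀).Homotopy f)
    (h₁ : ∀ s y y', r y y' → r (H₁ (s, y)) (H₁ (s, y')))
    (h₂ : ∀ s y y', r y y' → r (H₂ (s, y)) (H₂ (s, y'))) :
    ContractibleSpace Y ∧ ContractibleSpace (Quotient r) := by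
  refine ⟨contractibleSpace_of_homotopies ⟨H₁⟩ ⟨H₂⟩, ?_⟩
  have hf : ∀ y y', r y y' → r (f y) (f y') := fun y y' h ↦ by
    simpa only [H₁.apply_one] using h₁ 1 y y' h
  have e₁ := homotopic_quotientMapOf r H₁ h₁ (fun _ _ h ↦ h) hf
  have e₂ := homotopic_quotientMapOf r H₂ h₂ (fun _ _ _ ↦ Setoid.refl' r _) hf
  refine contractibleSpace_of_homotopies (f := quotientMapOf r f hf) (y₀ := Quotient.mk r y₀) ?_ ?_
  · convert e₁ using 1
    ext y
    induction y using Quotient.inductionOn with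
    | h y => rfl
  · convert e₂ using 1
    ext y
    induction y using Quotient.inductionOn with
    | h y => rfl

theorem contractibleSpace_and_quotient_of_homeomorph (e : Z ≃ₜ Y) (r : Setoid Y) {f : C(Z, Z)}
    {z₀ : Z} (H₁ : (ContinuousMap.id Z).Homotopy f) (H₂ : (ContinuousMap.const Z z₀).Homotopy f)
    (h₁ : ∀ s z z', r (e z) (e z') → r (e (H₁ (s, z))) (e (H₁ (s, z'))))
    (h₂ : ∀ s z z', r (e z) (e z') → r (e (H₂ (s, z))) (e (H₂ (s, z')))) :
    ContractibleSpace Y ∧ ContractibleSpace (Quotient r) := by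
  let c (g : C(Z, Z)) : C(Y, Y) := ((e : C(Z, Y)).comp g).comp (e.symm : C(Y, Z))
  let T {g g' : C(Z, Z)} (H : g.Homotopy g') : (c g).Homotopy (c g') :=
    { toFun x := e (H (x.1, e.symm x.2))
      continuous_toFun := by fun_prop
      map_zero_left y := congrArg e (H.apply_zero (e.symm y))
      map_one_left y := congrArg e (H.apply_one (e.symm y)) }
  have hid : c (ContinuousMap.id Z) = ContinuousMap.id Y :=
    ContinuousMap.ext fun y ↦ e.apply_symm_apply y
  refine contractibleSpace_and_quotient r (f := c f) (y₀ := e z₀)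
    ((T H₁).cast hid rfl) (T H₂) (fun s y y' h ↦ h₁ s _ _ ?_) (fun s y y' h ↦ h₂ s _ _ ?_)
  all_goals rwa [e.apply_symm_apply, e.apply_symm_apply]

end Quotient

/-! ### Conical contractibility, compatible with symmetries. -/

section Conical

variable {Q : Type w} [Preorder Q]

theorem orderRealizationMap_id :
    orderRealizationMap (OrderHom.id : Q →o Q) = ContinuousMap.id (OrderRealization Q) := by
  ext x
  obtain ⟨n, v, t, rfl⟩ := exists_chainPoint x
  rw [orderRealizationMap_chainPoint]
  rfl

theorem orderRealizationMap_const (q : Q) :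
    ∃ x₀, orderRealizationMap (OrderHom.const Q q) = ContinuousMap.const (OrderRealization Q) x₀ := by
  refine ⟨chainPoint (n := 0) (OrderHom.const _ q) default, ?_⟩
  ext x
  obtain ⟨n, v, t, rfl⟩ := exists_chainPoint x
  rw [orderRealizationMap_chainPoint]
  refine (chainPoint_comp (OrderHom.const (Fin 1) q) (OrderHom.const (Fin (n + 1)) 0) t).trans ?_
  exact congrArg _ (Subsingleton.elim _ _)

/-- A conically contractible preorder, `x ≥ T x ≤ q`, gives a contractible space, and also a
contractible quotient space by a relation generated by monotone maps that respect `T` and `q`. -/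
theorem contractibleSpace_of_conical {Y : Type*} [TopologicalSpace Y] (e : OrderRealization Q ≃ₜ Y)
    (r : Setoid Y) (T : Q →o Q) (q : Q) (hT : ∀ x, T x ≤ x) (hq : ∀ x, T x ≤ q)
    (A : Set (Q →o Q)) (hr : ∀ z z', r (e z) (e z') ↔ ∃ a ∈ A, z = orderRealizationMap a z')
    (hAT : ∀ a ∈ A, ∀ x, T (a x) = a (T x)) (hAq : ∀ a ∈ A, a q = q) :
    ContractibleSpace Y ∧ ContractibleSpace (Quotient r) := by
  obtain ⟨H₁, h₁⟩ := exists_homotopy_of_le (h₀ := T) (h₁ := OrderHom.id) hT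
  obtain ⟨H₂, h₂⟩ := exists_homotopy_of_le (h₀ := T) (h₁ := OrderHom.const Q q) hq
  obtain ⟨x₀, hx₀⟩ := orderRealizationMap_const q
  refine contractibleSpace_and_quotient_of_homeomorph e r (H₁.cast orderRealizationMap_id rfl)
    (H₂.cast hx₀ rfl) (fun s z z' h ↦ ?_) (fun s z z' h ↦ ?_)
  · obtain ⟨a, ha, rfl⟩ := (hr z z').1 h
    exact (hr _ _).2 ⟨a, ha, h₁ a a (hAT a ha) (fun _ ↦ rfl) s z'⟩
  · obtain ⟨a, ha, rfl⟩ := (hr z z').1 h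
    exact (hr _ _).2 ⟨a, ha, h₂ a a (hAT a ha) (fun _ ↦ (hAq a ha).symm) s z'⟩

end Conical

/-! ### Homotopy colimits of sets as nerves of preorders. -/

section Elements

variable {D : Type (u + 1)} [Category.{u} D]

/-- The elements of a diagram of sets, preordered by `x ≤ y` if some arrow maps `x` to `y`. -/
def ElementPreorder (K : D ⥤ Type u) : Type (u + 1) := Σ d : D, K.obj d

instance (K : D ⥤ Type u) : Preorder (ElementPreorder K) where
  le x y := ∃ f : x.1 ⟶ y.1, K.map f x.2 = y.2
  le_refl x := ⟨𝟙 x.1, by simp⟩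
  le_trans x y z := by
    rintro ⟨f, hf⟩ ⟨g, hg⟩
    exact ⟨f ≫ g, by rw [K.map_comp, ConcreteCategory.comp_apply, hf, hg]⟩

/-- The map from the homotopy colimit of a diagram of sets to the nerve of its preorder of
elements. -/
def hocolimToNerve (K : D ⥤ Type u) : hocolim K ⟶ orderNerve (ElementPreorder K) where
  app n := ↾fun a ↦ (⟨fun k ↦ ⟨a.1.obj k, K.map (a.1.map (homOfLE (Fin.zero_le k))) a.2⟩,
    fun _ _ h ↦ ⟨a.1.map (homOfLE h), (chain_map_map K a.1 _ _ _ a.2).symm⟩⟩ :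
      Fin (n.unop.len + 1) →o ElementPreorder K)
  naturality m n φ := by
    refine ConcreteCategory.hom_ext _ _ fun ⟨s, x⟩ ↦ ?_
    refine OrderHom.ext _ _ (funext fun k ↦ ?_)
    refine Sigma.ext rfl (heq_of_eq ?_)
    exact (chain_map_map K s _ _ _ x).symm

/-- An element of the diagram is sent to each other element by at most one arrow. -/
def HasThinElements (K : D ⥤ Type u) : Prop :=
  ∀ ⦃d d' : D⦄ (f f' : d ⟶ d') (x : K.obj d), K.map f x = K.map f' x → f = f'

/-- Thinness makes the arrows of a chain recoverable from the elements that it passes through, and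
makes arbitrary choices of arrows between comparable elements functorial. -/
theorem hocolimToNerve_bijective {K : D ⥤ Type u} (hK : HasThinElements K)
    (n : SimplexCategoryᵒᵖ) : Function.Bijective ((hocolimToNerve K).app n) := by
  constructor
  · rintro ⟨s, x⟩ ⟨s', x'⟩ h
    have hv (k : Fin (n.unop.len + 1)) :
        (⟨s.obj k, K.map (s.map (homOfLE (Fin.zero_le k))) x⟩ : Σ d : D, K.obj d) =
          ⟨s'.obj k, K.map (s'.map (homOfLE (Fin.zero_le k))) x'⟩ :=
      DFunLike.congr_fun (F := Fin (n.unop.len + 1) →o ElementPreorder K) h k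
    -- The functors are taken apart so that their object maps can be identified first; only then do
    -- the equalities of elements and arrows typecheck without transport.
    obtain ⟨o, m, hid, hcomp⟩ := s
    obtain ⟨o', m', hid', hcomp'⟩ := s'
    obtain rfl : o = o' := funext fun k ↦ congrArg Sigma.fst (hv k)
    have hv' (k : Fin (n.unop.len + 1)) :
        K.map (m (homOfLE (Fin.zero_le k))) x = K.map (m' (homOfLE (Fin.zero_le k))) x' :=
      eq_of_heq (Sigma.ext_iff.1 (hv k)).2
    have h0 : x = x' := by
      have h := hv' 0
      have e (m : ∀ {i j : Fin (n.unop.len + 1)}, (i ⟶ j) → (o i ⟶ o j))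
          (hid : m (𝟙 0) = 𝟙 (o 0)) (x : K.obj (o 0)) :
          K.map (m (homOfLE (Fin.zero_le 0))) x = x := by
        rw [show homOfLE (Fin.zero_le (0 : Fin (n.unop.len + 1))) = 𝟙 0 from rfl, hid]
        simp
      rwa [e m (hid 0), e m' (hid' 0)] at h
    subst h0
    obtain rfl : @m = @m' := by
      funext i j f
      refine hK _ _ (K.map (m (homOfLE (Fin.zero_le i))) x) ?_
      have e1 := chain_map_map K ⟨o, m, hid, hcomp⟩ (homOfLE (Fin.zero_le i)) f
        (homOfLE (Fin.zero_le j)) x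
      have e2 := chain_map_map K ⟨o, m', hid', hcomp'⟩ (homOfLE (Fin.zero_le i)) f
        (homOfLE (Fin.zero_le j)) x
      refine e1.symm.trans ((hv' j).trans (e2.trans ?_))
      exact congrArg (K.map (m' f)) (hv' i).symm
    rfl
  · intro (v : Fin (n.unop.len + 1) →o ElementPreorder K)
    choose f hf using fun (i j : Fin (n.unop.len + 1)) (h : i ≤ j) ↦ v.monotone h
    let s : ComposableArrows D n.unop.len :=
      { obj k := (v k).1
        map {i j} h := f i j (leOfHom h)
        map_id i := hK _ _ (v i).2 ((hf _ _ _).trans (by simp))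
        map_comp {i j k} h h' := hK _ _ (v i).2 (by
          rw [hf, K.map_comp, ConcreteCategory.comp_apply, hf, hf]) }
    refine ⟨⟨s, (v 0).2⟩, ?_⟩
    refine OrderHom.ext _ _ (funext fun k ↦ ?_)
    exact Sigma.ext rfl (heq_of_eq (hf 0 k _))

theorem isIso_hocolimToNerve {K : D ⥤ Type u} (hK : HasThinElements K) :
    IsIso (hocolimToNerve K) := by
  have (n : SimplexCategoryᵒᵖ) : IsIso ((hocolimToNerve K).app n) :=
    (isIso_iff_bijective _).2 (hocolimToNerve_bijective hK n)
  exact NatIso.isIso_of_isIso_app _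

/-- The realization of the homotopy colimit is that of the preorder of elements. -/
def hocolimHomeomorph {K : D ⥤ Type u} (hK : HasThinElements K) :
    SSet.toTop.obj (hocolim K) ≃ₜ OrderRealization (ElementPreorder K) :=
  have := isIso_hocolimToNerve hK
  TopCat.homeoOfIso (SSet.toTop.mapIso (asIso (hocolimToNerve K)))

/-- A natural transformation acts on the preorder of elements. -/
def elementMap {K K' : D ⥤ Type u} (η : K ⟶ K') : ElementPreorder K →o ElementPreorder K' where
  toFun x := ⟨x.1, η.app x.1 x.2⟩
  monotone' := by
    rintro x y ⟨f, hf⟩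
    refine ⟨f, ?_⟩
    change K'.map f (η.app x.1 x.2) = η.app y.1 y.2
    rw [← hf, ← NatTrans.naturality_apply]

theorem hocolimHomeomorph_map {K : D ⥤ Type u} (hK : HasThinElements K) (η : K ⟶ K)
    (x : SSet.toTop.obj (hocolim K)) :
    hocolimHomeomorph hK (SSet.toTop.map (hocolimMap η) x) =
      orderRealizationMap (elementMap η) (hocolimHomeomorph hK x) := by
  have h : hocolimMap η ≫ hocolimToNerve K = hocolimToNerve K ≫ orderNerveMap (elementMap η) := by
    refine NatTrans.ext (funext fun n ↦ ConcreteCategory.hom_ext _ _ fun ⟨s, x⟩ ↦ ?_)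
    refine OrderHom.ext _ _ (funext fun k ↦ ?_)
    refine Sigma.ext rfl (heq_of_eq ?_)
    exact (NatTrans.naturality_apply η _ x).symm
  have h' := congrArg (SSet.toTop.map ·) h
  simp only [Functor.map_comp] at h'
  exact ConcreteCategory.congr_hom h' x

end Elements

/-! ### Fixed points of the homotopy colimit of a diagram of `G`-sets. -/

section FixedPoints

variable {D : Type (u + 1)} [Category.{u} D] {G : Type u} [Group G] (F : D ⥤ Action (Type u) G)

/-- The elements of a diagram of `G`-sets. -/
abbrev GElements : Type (u + 1) := ElementPreorder (F ⋙ Action.forget (Type u) G)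

/-- The action of `g` on the elements of a diagram of `G`-sets. -/
def elementAct (g : G) : GElements F →o GElements F := elementMap (actNatTrans F g)

theorem elementAct_mul (g h : G) (x : GElements F) :
    elementAct F (g * h) x = elementAct F g (elementAct F h x) := by
  obtain ⟨d, x⟩ := x
  exact congrArg (Sigma.mk (β := fun d ↦ (F.obj d).V) d)
    (ConcreteCategory.congr_hom ((F.obj d).ρ.map_mul g h) x)

/-- The elements fixed by a subgroup. -/
def fixedElements (P : Subgroup G) : Set (GElements F) := {x | ∀ g ∈ P, elementAct F g x = x}

/-- The maps of the diagram are equivariant, so they carry `P`-fixed elements to `P`-fixed elements.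
-/
theorem isUpperSet_fixedElements (P : Subgroup G) : IsUpperSet (fixedElements F P) := by
  rintro x y ⟨f, hf⟩ hx g hg
  refine Sigma.ext rfl (heq_of_eq ?_)
  have h : (actNatTrans F g).app x.1 x.2 = x.2 := eq_of_heq (Sigma.ext_iff.1 (hx g hg)).2
  change (actNatTrans F g).app y.1 y.2 = y.2
  rw [← hf, NatTrans.naturality_apply, h]

theorem elementAct_mem_fixedElements {P : Subgroup G} {c : G}
    (hc : c ∈ Subgroup.centralizer (P : Set G)) {x : GElements F} (hx : x ∈ fixedElements F P) :
    elementAct F c x ∈ fixedElements F P := fun g hg ↦ by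
  rw [← elementAct_mul, Subgroup.mem_centralizer_iff.1 hc g hg, elementAct_mul, hx g hg]

/-- The action of the centralizer of `P` on the elements fixed by `P`. -/
def fixedElementAct (P : Subgroup G) (c : Subgroup.centralizer (P : Set G)) :
    fixedElements F P →o fixedElements F P where
  toFun x := ⟨elementAct F c x, elementAct_mem_fixedElements F c.2 x.2⟩
  monotone' _ _ h := (elementAct F c).monotone h

/-- The realization of the homotopy colimit of a diagram of `G`-sets. -/
abbrev hocolimSpace : Action TopCat.{u + 1} G :=
  (SSet.toTop.{u + 1}.mapAction G).obj (hocolimAction F)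

variable {F}

theorem hocolimHomeomorph_smul (hF : HasThinElements (F ⋙ Action.forget (Type u) G))
    (g : G) (x : (hocolimSpace F).V) :
    hocolimHomeomorph hF (g • x) = orderRealizationMap (elementAct F g) (hocolimHomeomorph hF x) :=
  hocolimHomeomorph_map hF (actNatTrans F g) x

theorem orderRealizationMap_comp {Q Q' Q'' : Type w} [Preorder Q] [Preorder Q'] [Preorder Q'']
    (f : Q →o Q') (f' : Q' →o Q'') (x : OrderRealization Q) :
    orderRealizationMap f' (orderRealizationMap f x) = orderRealizationMap (f'.comp f) x := by
  obtain ⟨n, v, t, rfl⟩ := exists_chainPoint x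
  rw [orderRealizationMap_chainPoint, orderRealizationMap_chainPoint,
    orderRealizationMap_chainPoint]
  rfl

/-- A point of the homotopy colimit is fixed by `P` if and only if it lies in the realization of the
elements fixed by `P`. -/
theorem mem_fixedPoints_iff (hF : HasThinElements (F ⋙ Action.forget (Type u) G))
    (P : Subgroup G) (x : (hocolimSpace F).V) :
    x ∈ fixedPoints (hocolimSpace F).V P ↔ hocolimHomeomorph hF x ∈
      Set.range (orderRealizationMap (upperInclusion (fixedElements F P))) := by
  constructor
  · intro hx
    obtain ⟨n, v, t, hv⟩ := exists_chainPoint (hocolimHomeomorph hF x)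
    obtain ⟨k, hk, hk'⟩ := stdSimplex_exists_first t
    obtain ⟨first, hfirst⟩ := exists_firstVertex (GElements F)
    rw [← hv]
    -- It suffices that the first vertex of positive weight is fixed. The element `g` moves the
    -- chain but keeps the coordinates `t`, so it takes the first vertex of `x` to that of `g • x =
    -- x`.
    refine mem_range_upperInclusion (isUpperSet_fixedElements F P) v t hk' fun g hg ↦ ?_
    have h1 : g • x = x := hx ⟨g, hg⟩
    have h2 := hocolimHomeomorph_smul hF g x
    rw [h1, ← hv, orderRealizationMap_chainPoint] at h2
    have h3 := congrArg first h2
    rw [hfirst n v t k hk hk', hfirst n _ t k hk hk'] at h3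
    exact h3.symm
  · rintro ⟨z, hz⟩ ⟨g, hg⟩
    apply (hocolimHomeomorph hF).injective
    refine (hocolimHomeomorph_smul hF g x).trans ?_
    rw [← hz, orderRealizationMap_comp]
    congr 2
    ext y : 2
    exact y.2 g hg

theorem exists_homeomorph_fixedPoints (hF : HasThinElements (F ⋙ Action.forget (Type u) G))
    (P : Subgroup G) :
    ∃ e : OrderRealization (fixedElements F P) ≃ₜ fixedPoints (hocolimSpace F).V P,
      ∀ (c : Subgroup.centralizer (P : Set G)) (z : OrderRealization (fixedElements F P)),
        e (orderRealizationMap (fixedElementAct F P c) z) = c • e z := by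
  let j : OrderRealization (fixedElements F P) → (hocolimSpace F).V :=
    (hocolimHomeomorph hF).symm ∘ orderRealizationMap (upperInclusion (fixedElements F P))
  have hj : Topology.IsEmbedding j := (hocolimHomeomorph hF).symm.isEmbedding.comp
    (isEmbedding_upperInclusion (isUpperSet_fixedElements F P))
  have hrange : Set.range j = {x | x ∈ fixedPoints (hocolimSpace F).V P} := by
    ext x
    refine Iff.trans ?_ (mem_fixedPoints_iff hF P x).symm
    constructor
    · rintro ⟨z, rfl⟩
      exact ⟨z, ((hocolimHomeomorph hF).apply_symm_apply _).symm⟩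
    · rintro ⟨z, hz⟩
      exact ⟨z, (hocolimHomeomorph hF).symm_apply_eq.2 hz⟩
  refine ⟨hj.toHomeomorph.trans (Homeomorph.setCongr hrange), fun c z ↦ Subtype.ext ?_⟩
  change j _ = (c : G) • j z
  refine (hocolimHomeomorph hF).injective ((hocolimHomeomorph hF).apply_symm_apply _ |>.trans ?_)
  rw [hocolimHomeomorph_smul]
  change _ = orderRealizationMap _ ((hocolimHomeomorph hF) ((hocolimHomeomorph hF).symm _))
  rw [Homeomorph.apply_symm_apply, orderRealizationMap_comp, orderRealizationMap_comp]
  rfl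

theorem contractibleSpace_fixedPoints (hF : HasThinElements (F ⋙ Action.forget (Type u) G))
    (P : Subgroup G) (T : fixedElements F P →o fixedElements F P) (q : fixedElements F P) (hT : ∀ x, T x ≤ x)
    (hq : ∀ x, T x ≤ q) (hTc : ∀ c x, T (fixedElementAct F P c x) = fixedElementAct F P c (T x))
    (hqc : ∀ c, fixedElementAct F P c q = q) :
    ContractibleSpace (fixedPoints (hocolimSpace F).V P) ∧
      ContractibleSpace (fixedPointsOrbitSpace (hocolimSpace F).V P) := by
  obtain ⟨e, he⟩ := exists_homeomorph_fixedPoints hF P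
  refine contractibleSpace_of_conical e _ T q hT hq (Set.range (fixedElementAct F P)) ?_ ?_ ?_
  · intro z z'
    rw [MulAction.orbitRel_apply]
    constructor
    · rintro ⟨c, hc⟩
      refine ⟨_, ⟨c, rfl⟩, e.injective ?_⟩
      rw [he]
      exact hc.symm
    · rintro ⟨_, ⟨c, rfl⟩, rfl⟩
      exact ⟨c, (he c z').symm⟩
  · rintro _ ⟨c, rfl⟩
    exact hTc c
  · rintro _ ⟨c, rfl⟩
    exact hqc c

end FixedPoints

/-! ### The preorder of monomorphisms into `G`. -/

section ConjugacyElements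

open Opposite

variable {G : Type u} [Group G] {𝓒 : Set (Subgroup G)}

/-- Monomorphisms are left cancellable. -/
theorem conjClassFunctor_hasThinElements :
    HasThinElements (conjClassFunctor 𝓒 ⋙ Action.forget (Type u) G) := by
  intro d d' f f' x h
  have hx : Function.Injective x.1 := d.unop.injective x.1 x.2
  have h' : x.1.comp f.unop.toMonoidHom = x.1.comp f'.unop.toMonoidHom := congrArg Subtype.val h
  apply Quiver.Hom.unop_inj
  apply ConjugacyCategory.Hom.ext
  ext k
  exact hx (DFunLike.congr_fun h' k)

/-- The monomorphism underlying an element of the diagram of conjugacy classes. -/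
def elementHom (x : GElements (conjClassFunctor 𝓒)) : x.1.unop.carrier →* G := x.2.1

theorem elementHom_injective (x : GElements (conjClassFunctor 𝓒)) :
    Function.Injective (elementHom x) := x.1.unop.injective x.2.1 x.2.2

theorem elementHom_range_mem (x : GElements (conjClassFunctor 𝓒)) :
    (elementHom x).range ∈ 𝓒 := x.1.unop.range_mem x.2.1 x.2.2

/-- An arrow in the opposite category from `x` to `y` is a factorization of the monomorphism of `y`
through that of `x`. It exists as soon as the images are nested, since the monomorphism of `x` is
invertible on its image. -/
theorem element_le_iff (x y : GElements (conjClassFunctor 𝓒)) :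
    x ≤ y ↔ (elementHom y).range ≤ (elementHom x).range := by
  constructor
  · rintro ⟨f, hf⟩
    have h : (elementHom x).comp f.unop.toMonoidHom = elementHom y := congrArg Subtype.val hf
    rw [← h]
    rintro _ ⟨k, rfl⟩
    exact ⟨f.unop.toMonoidHom k, rfl⟩
  · intro h
    let e := MonoidHom.ofInjective (elementHom_injective x)
    let f : y.1.unop.carrier →* x.1.unop.carrier :=
      e.symm.toMonoidHom.comp ((Subgroup.inclusion h).comp (elementHom y).rangeRestrict)
    have hf : (elementHom x).comp f = elementHom y := by
      ext k
      exact congrArg Subtype.val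
        (e.apply_symm_apply (Subgroup.inclusion h ((elementHom y).rangeRestrict k)))
    have hcls : y.1.unop.cls = x.1.unop.cls.precomp f :=
      y.2.2.symm.trans ((congrArg ConjHom.mk hf.symm).trans
        (congrArg (ConjHom.precomp · f) x.2.2))
    exact ⟨Quiver.Hom.op (⟨f, hcls⟩ : ConjugacyCategory.Hom y.1.unop x.1.unop), Subtype.ext hf⟩

theorem mem_fixedElements_iff (P : Subgroup G) (x : GElements (conjClassFunctor 𝓒)) :
    x ∈ fixedElements (conjClassFunctor 𝓒) P ↔ ∀ g ∈ P, ∀ k, Commute (elementHom x k) g := by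
  refine forall₂_congr fun g _ ↦ ?_
  constructor
  · intro h k
    have h' : (MulAut.conj g).toMonoidHom.comp (elementHom x) = elementHom x :=
      congrArg Subtype.val (eq_of_heq (Sigma.ext_iff.1 h).2)
    have := DFunLike.congr_fun h' k
    exact (mul_inv_eq_iff_eq_mul.1 this).symm
  · intro h
    refine Sigma.ext rfl (heq_of_eq (Subtype.ext (MonoidHom.ext fun k ↦ ?_)))
    exact mul_inv_eq_iff_eq_mul.2 (h k).eq.symm

/-- The element given by a monomorphism `i : K → G`. -/
def homElement (hconj : ∀ g : G, ∀ E ∈ 𝓒, E.map (MulAut.conj g).toMonoidHom ∈ 𝓒) {K : Type u}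
    [Group K] (i : K →* G) (hi : Function.Injective i) (hr : i.range ∈ 𝓒) :
    GElements (conjClassFunctor 𝓒) :=
  ⟨op { carrier := K
        cls := ConjHom.mk i
        injective := fun j hj ↦ by
          obtain ⟨g, rfl⟩ := ConjHom.mk_eq_iff.1 hj.symm
          exact (MulAut.conj g).injective.comp hi
        range_mem := fun j hj ↦ by
          obtain ⟨g, rfl⟩ := ConjHom.mk_eq_iff.1 hj.symm
          rw [MonoidHom.range_comp]
          exact hconj g _ hr }, ⟨i, rfl⟩⟩

variable (hconj : ∀ g : G, ∀ E ∈ 𝓒, E.map (MulAut.conj g).toMonoidHom ∈ 𝓒)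

/-- The classes of conjugate monomorphisms are equal only propositionally; once they are identified,
the elements differ in nothing but proofs. -/
theorem element_ext {K : Type u} [Group K] {c c' : ConjHom K G} (hc : c = c') {h₁ h₂ h₁' h₂'}
    {i i' : K →* G} (hi : ConjHom.mk i = c) (hi' : ConjHom.mk i' = c') (h : i = i') :
    (⟨op ⟨K, c, h₁, h₂⟩, ⟨i, hi⟩⟩ : GElements (conjClassFunctor 𝓒)) =
      ⟨op ⟨K, c', h₁', h₂'⟩, ⟨i', hi'⟩⟩ := by
  subst hc h
  rfl

theorem homElement_conj {K : Type u} [Group K] (g : G) (i j : K →* G) (hi : Function.Injective i)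
    (hr : i.range ∈ 𝓒) (hj : Function.Injective j) (hr' : j.range ∈ 𝓒)
    (h : j = (MulAut.conj g).toMonoidHom.comp i) :
    homElement hconj j hj hr' =
      elementAct (conjClassFunctor 𝓒) g (homElement hconj i hi hr) :=
  element_ext (ConjHom.mk_eq_iff.2 ⟨g, h⟩).symm _ _ h

/-- The element given by the monomorphism `K / ker m → G` induced by `m`. -/
def quotientElement {K : Type u} [Group K] (m : K →* G) (hr : m.range ∈ 𝓒) (N : Subgroup K)
    [N.Normal] (hN : N = m.ker) : GElements (conjClassFunctor 𝓒) :=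
  homElement hconj (QuotientGroup.lift N m hN.le)
    ((injective_iff_map_eq_one _).2 fun a ha ↦ by
      induction a using QuotientGroup.induction_on with
      | H a => exact (QuotientGroup.eq_one_iff a).2 (hN ▸ ha))
    (by
      convert hr using 1
      ext y
      constructor
      · rintro ⟨a, rfl⟩
        induction a using QuotientGroup.induction_on with
        | H a => exact ⟨a, rfl⟩
      · rintro ⟨a, rfl⟩
        exact ⟨a, rfl⟩)

theorem elementHom_quotientElement_range {K : Type u} [Group K] (m : K →* G) (hr : m.range ∈ 𝓒)
    (N : Subgroup K) [N.Normal] (hN : N = m.ker) :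
    (elementHom (quotientElement hconj m hr N hN)).range = m.range := by
  ext y
  constructor
  · rintro ⟨a, rfl⟩
    induction a using QuotientGroup.induction_on with
    | H a => exact ⟨a, rfl⟩
  · rintro ⟨a, rfl⟩
    exact ⟨QuotientGroup.mk a, rfl⟩

theorem quotientElement_conj {K : Type u} [Group K] (g : G) (m m' : K →* G) (hr : m.range ∈ 𝓒)
    (hr' : m'.range ∈ 𝓒) (N N' : Subgroup K) [N.Normal] [N'.Normal] (hN : N = m.ker)
    (hN' : N' = m'.ker) (h : m' = (MulAut.conj g).toMonoidHom.comp m) :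
    quotientElement hconj m' hr' N' hN' =
      elementAct (conjClassFunctor 𝓒) g (quotientElement hconj m hr N hN) := by
  -- Conjugation does not change the kernel, so both monomorphisms have the same domain `K / N`.
  -- Keeping `N` as a variable, separate from `m.ker`, is what permits this substitution.
  obtain rfl : N = N' := by
    rw [hN, hN', h]
    ext a
    exact (map_eq_one_iff (MulAut.conj g) (MulAut.conj g).injective).symm
  refine homElement_conj hconj g _ _ _ _ _ _ ?_
  subst h
  ext a
  rfl

/-- Suppose that a central subgroup `Z ∈ 𝓒` of `P` can be adjoined to each member of `𝓒` that
centralizes `P`. Then the fixed points of `P` on the Dwyer space of `𝓒`, and their orbit space, are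
contractible. -/
theorem contractibleSpace_dwyerSpace (P Z : Subgroup G) (hZP : Z ≤ P) (hZ : Z ∈ 𝓒)
    (hcomm : ∀ z ∈ Z, ∀ g ∈ P, Commute z g)
    (hconj : ∀ g : G, ∀ E ∈ 𝓒, E.map (MulAut.conj g).toMonoidHom ∈ 𝓒)
    (hsup : ∀ E ∈ 𝓒, (∀ x ∈ E, ∀ z ∈ Z, Commute x z) → E ⊔ Z ∈ 𝓒) :
    ContractibleSpace (fixedPoints (dwyerSpace 𝓒).V P) ∧
      ContractibleSpace (fixedPointsOrbitSpace (dwyerSpace 𝓒).V P) := by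
  let U := fixedElements (conjClassFunctor 𝓒) P
  have hU (x : U) : ∀ g ∈ P, ∀ k, Commute (elementHom x.1 k) g := (mem_fixedElements_iff P x.1).1 x.2
  let m (x : U) : x.1.1.unop.carrier × Z →* G :=
    (elementHom x.1).noncommCoprod Z.subtype fun k z ↦ hU x z (hZP z.2) k
  have hm (x : U) : (m x).range = (elementHom x.1).range ⊔ Z :=
    (MonoidHom.noncommCoprod_range _ _ _).trans
      (congrArg ((elementHom x.1).range ⊔ ·) Z.range_subtype)
  have hmem (x : U) : (m x).range ∈ 𝓒 := by
    rw [hm]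
    refine hsup _ (elementHom_range_mem x.1) ?_
    rintro _ ⟨k, rfl⟩ z hz
    exact hU x z (hZP hz) k
  -- The quotient of `H × Z` is used instead of the subgroup `EZ` itself: the group action on
  -- elements keeps the domain, whereas conjugation would move `EZ`. The quotient is needed since
  -- `E` may meet `Z`.
  let T₀ (x : U) : GElements (conjClassFunctor 𝓒) :=
    quotientElement hconj (m x) (hmem x) (m x).ker rfl
  have hT₀ (x : U) : (elementHom (T₀ x)).range = (elementHom x.1).range ⊔ Z :=
    (elementHom_quotientElement_range hconj _ _ _ _).trans (hm x)
  have hT₀U (x : U) : T₀ x ∈ U := by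
    refine (mem_fixedElements_iff P _).2 fun g hg k ↦ ?_
    have hk : elementHom (T₀ x) k ∈ (m x).range := by
      rw [hm, ← hT₀]
      exact ⟨k, rfl⟩
    obtain ⟨⟨a, z⟩, h⟩ := hk
    rw [← h]
    exact (hU x g hg a).mul_left (hcomm z z.2 g hg)
  let T : U →o U :=
    { toFun x := ⟨T₀ x, hT₀U x⟩
      monotone' := fun x y h ↦ by
        refine (element_le_iff _ _).2 ?_
        rw [hT₀, hT₀]
        exact sup_le_sup_right ((element_le_iff _ _).1 h) Z }
  have hZr : Z.subtype.range ∈ 𝓒 := by rwa [Subgroup.range_subtype]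
  let q : U := ⟨homElement hconj Z.subtype Z.subtype_injective hZr,
    (mem_fixedElements_iff P _).2 fun g hg z ↦ hcomm z.1 z.2 g hg⟩
  refine contractibleSpace_fixedPoints conjClassFunctor_hasThinElements P T q ?_ ?_ ?_ ?_
  · intro x
    exact (element_le_iff _ _).2 (le_sup_left.trans (hT₀ x).ge)
  · intro x
    exact (element_le_iff _ _).2 (Z.range_subtype.le.trans (le_sup_right.trans (hT₀ x).ge))
  · intro c x
    refine Subtype.ext ?_
    let m' : x.1.1.unop.carrier × Z →* G := m (fixedElementAct _ P c x)
    refine quotientElement_conj hconj (c : G) (m x) m' (hmem x) (hmem (fixedElementAct _ P c x))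
      (m x).ker m'.ker rfl rfl ?_
    -- As `c` fixes `Z` pointwise, conjugating only the factor `H` of `m x` is the same as
    -- conjugating all of `m x`.
    have hc (z : G) (hz : z ∈ P) : c * z * (c : G)⁻¹ = z := by
      rw [mul_inv_eq_iff_eq_mul]
      exact (Subgroup.mem_centralizer_iff.1 c.2 z hz).symm
    refine MonoidHom.ext fun ⟨k, z⟩ ↦ ?_
    change c * elementHom x.1 k * (c : G)⁻¹ * z = c * (elementHom x.1 k * z) * (c : G)⁻¹
    nth_rewrite 1 [← hc z (hZP z.2)]
    group
  · intro c
    refine Subtype.ext (homElement_conj hconj (c : G) Z.subtype Z.subtype Z.subtype_injective hZr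
      Z.subtype_injective hZr ?_).symm
    ext z
    change (z : G) = c * z * (c : G)⁻¹
    rw [eq_mul_inv_iff_mul_eq]
    exact Subgroup.mem_centralizer_iff.1 c.2 z (hZP z.2)

end ConjugacyElements

/-! ### Closure properties of elementary abelian subgroups, and the central subgroup `Z`. -/

section ElementaryAbelian

variable {G : Type u} [Group G] {p : ℕ}

theorem map_conj_mem_elementaryAbelianSubgroups (g : G) {E : Subgroup G}
    (hE : E ∈ elementaryAbelianSubgroups p G) :
    E.map (MulAut.conj g).toMonoidHom ∈ elementaryAbelianSubgroups p G := by
  obtain ⟨h0, h1, h2⟩ := hE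
  refine ⟨?_, ?_, ?_⟩
  · rwa [Ne, Subgroup.map_eq_bot_iff_of_injective _ (MulAut.conj g).injective]
  · rintro _ ⟨x, hx, rfl⟩ _ ⟨y, hy, rfl⟩
    rw [← map_mul, ← map_mul, h1 x hx y hy]
  · rintro _ ⟨x, hx, rfl⟩
    rw [← map_pow, h2 x hx, map_one]

theorem map_conj_mem_finiteElementaryAbelianSubgroups (g : G) {E : Subgroup G}
    (hE : E ∈ finiteElementaryAbelianSubgroups p G) :
    E.map (MulAut.conj g).toMonoidHom ∈ finiteElementaryAbelianSubgroups p G := by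
  have := hE.2
  exact ⟨map_conj_mem_elementaryAbelianSubgroups g hE.1, Finite.Set.finite_image (E : Set G) _⟩

/-- For commuting subgroups multiplication `E × Z → G` is a homomorphism, and its image is the join.
-/
theorem exists_mul_of_mem_sup {E Z : Subgroup G} (h : ∀ x ∈ E, ∀ z ∈ Z, Commute x z) {y : G}
    (hy : y ∈ E ⊔ Z) : ∃ x ∈ E, ∃ z ∈ Z, x * z = y := by
  let f : E × Z →* G := E.subtype.noncommCoprod Z.subtype fun x z ↦ h x x.2 z z.2
  have hf : f.range = E ⊔ Z := (MonoidHom.noncommCoprod_range _ _ _).trans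
    (congrArg₂ (· ⊔ ·) E.range_subtype Z.range_subtype)
  rw [← hf] at hy
  obtain ⟨⟨x, z⟩, rfl⟩ := hy
  exact ⟨x, x.2, z, z.2, rfl⟩

theorem sup_mem_elementaryAbelianSubgroups {E Z : Subgroup G}
    (hE : E ∈ elementaryAbelianSubgroups p G) (hZ : Z ∈ elementaryAbelianSubgroups p G)
    (h : ∀ x ∈ E, ∀ z ∈ Z, Commute x z) : E ⊔ Z ∈ elementaryAbelianSubgroups p G := by
  refine ⟨fun h0 ↦ hE.1 (eq_bot_iff.2 (le_sup_left.trans h0.le)), fun a ha b hb ↦ ?_, fun a ha ↦ ?_⟩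
  · obtain ⟨x, hx, z, hz, rfl⟩ := exists_mul_of_mem_sup h ha
    obtain ⟨x', hx', z', hz', rfl⟩ := exists_mul_of_mem_sup h hb
    have c1 : Commute x x' := hE.2.1 x hx x' hx'
    have c2 : Commute z z' := hZ.2.1 z hz z' hz'
    exact ((c1.mul_right (h x hx z' hz')).mul_left
      ((h x' hx' z hz).symm.mul_right c2)).eq
  · obtain ⟨x, hx, z, hz, rfl⟩ := exists_mul_of_mem_sup h ha
    rw [(h x hx z hz).mul_pow, hE.2.2 x hx, hZ.2.2 z hz, one_mul]

theorem sup_mem_finiteElementaryAbelianSubgroups {E Z : Subgroup G}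
    (hE : E ∈ finiteElementaryAbelianSubgroups p G)
    (hZ : Z ∈ finiteElementaryAbelianSubgroups p G)
    (h : ∀ x ∈ E, ∀ z ∈ Z, Commute x z) : E ⊔ Z ∈ finiteElementaryAbelianSubgroups p G := by
  refine ⟨sup_mem_elementaryAbelianSubgroups hE.1 hZ.1 h, ?_⟩
  have := hE.2
  have := hZ.2
  refine Finite.of_surjective (fun x : E × Z ↦ (⟨x.1 * x.2, Subgroup.mul_mem_sup x.1.2 x.2.2⟩ :
    (E ⊔ Z : Subgroup G))) fun ⟨y, hy⟩ ↦ ?_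
  obtain ⟨x, hx, z, hz, rfl⟩ := exists_mul_of_mem_sup h hy
  exact ⟨(⟨x, hx⟩, ⟨z, hz⟩), rfl⟩

/-- A nontrivial finite `p`-group contains a central subgroup of order `p`. -/
theorem exists_central_elementaryAbelian (hp : p.Prime) (P : Subgroup G) (hP : IsPGroup p P)
    [Finite P] (hnt : P ≠ ⊥) :
    ∃ Z ≤ P, Z ∈ finiteElementaryAbelianSubgroups p G ∧ ∀ z ∈ Z, ∀ g ∈ P, Commute z g := by
  have : Fact p.Prime := ⟨hp⟩
  have : Nontrivial P := (Subgroup.nontrivial_iff_ne_bot P).2 hnt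
  have := hP.center_nontrivial
  have hdvd : p ∣ Nat.card (Subgroup.center P) :=
    (hP.to_subgroup (Subgroup.center P)).card_eq_or_dvd.resolve_left Finite.one_lt_card.ne'
  -- Cauchy's theorem in the center, which is nontrivial because `P` is a nontrivial finite
  -- `p`-group; `Z` is generated by `z`.
  obtain ⟨z, hz⟩ := exists_prime_orderOf_dvd_card' p hdvd
  let g : G := ((z : P) : G)
  have hg : orderOf g = p := by rw [Subgroup.orderOf_coe, Subgroup.orderOf_coe, hz]
  have hle : Subgroup.zpowers g ≤ P := Subgroup.zpowers_le.2 (z : P).2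
  refine ⟨Subgroup.zpowers g, hle, ⟨⟨?_, ?_, ?_⟩, ?_⟩, ?_⟩
  · rw [Ne, Subgroup.zpowers_eq_bot]
    intro h1
    rw [h1, orderOf_one] at hg
    exact hp.one_lt.ne hg
  · rintro _ ⟨a, rfl⟩ _ ⟨b, rfl⟩
    exact ((Commute.refl g).zpow_zpow a b).eq
  · rintro _ ⟨a, rfl⟩
    change (g ^ a) ^ p = 1
    rw [← zpow_natCast, zpow_comm, zpow_natCast, ← hg, pow_orderOf_eq_one, one_zpow]
  · exact Finite.of_injective _ (Subgroup.inclusion_injective hle)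
  · rintro _ ⟨a, rfl⟩ x hx
    refine Commute.zpow_left ?_ a
    exact (congrArg Subtype.val (Subgroup.mem_center_iff.1 z.2 ⟨x, hx⟩)).symm

end ElementaryAbelian

end Dwyer

end

theorem proposition6 {G : Type u} [Group G] (p : ℕ) (hp : p.Prime) (𝓔 : Set (Subgroup G))
    (h𝓔 : 𝓔 = Dwyer.elementaryAbelianSubgroups p G ∨
      𝓔 = Dwyer.finiteElementaryAbelianSubgroups p G)
    (P : Subgroup G) (hP : IsPGroup p P) [Finite P] (hnt : P ≠ ⊥) :
    ContractibleSpace (Dwyer.fixedPoints (Dwyer.dwyerSpace 𝓔).V P) ∧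
      ContractibleSpace (Dwyer.fixedPointsOrbitSpace (Dwyer.dwyerSpace 𝓔).V P) := by
  obtain ⟨Z, hZP, hZ, hcomm⟩ := Dwyer.exists_central_elementaryAbelian hp P hP hnt
  rcases h𝓔 with rfl | rfl
  · exact Dwyer.contractibleSpace_dwyerSpace P Z hZP hZ.1 hcomm
      (fun g _ hE ↦ Dwyer.map_conj_mem_elementaryAbelianSubgroups g hE)
      (fun _ hE h ↦ Dwyer.sup_mem_elementaryAbelianSubgroups hE hZ.1 h)
  · exact Dwyer.contractibleSpace_dwyerSpace P Z hZP hZ hcomm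
      (fun g _ hE ↦ Dwyer.map_conj_mem_finiteElementaryAbelianSubgroups g hE)
      (fun _ hE h ↦ Dwyer.sup_mem_finiteElementaryAbelianSubgroups hE hZ h)
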